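/- **Conventions.** Let $\mathbb K=\mathbb R$ or $\mathbb C$. Manifolds are Hausdorff (not necessarily second countable), and either smooth or real analytic (when $\mathbb K=\mathbb R$) or complex (when $\mathbb K=\mathbb C$); tensor fields and maps are smooth, real analytic or holomorphic accordingly. Dimensions are over $\mathbb K$. * A *Jacobi manifold* $(M,\pi_M,E_M)$ is a manifold with a bivector field $\pi_M$ and a vector field $E_M$ such that $[\pi_M,\pi_M]=2E_M\wedge\pi_M$ and $[E_M,\pi_M]=0$. The sign of the Schouten bracket is the one for which $[\pi,\pi](df,dg,dh)=2\big(\{\{f,g\}_\pi,h\}_\pi+\{\{g,h\}_\pi,f\}_\pi+\{\{h,f\}_\pi,g\}_\pi\big)$ with $\{f,g\}_\pi=\pi(df,dg)$; equivalently, $\{f,g\}=\pi_M(df,dg)+f\,E_M[g]-g\,E_M[f]$ satisfies the Jacobi identity. It is a *contact manifold* if it has dimension $2n+1$ and $E_M\wedge\pi_M^{\,n}$ vanishes at no point. * A *contact resolution* of a Jacobi manifold $(M,\pi_M,E_M)$ of dimension $2n+1$ is a contact manifold $(\Sigma,\pi_\Sigma,E_\Sigma)$ of dimension $2n+1$ with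 a surjective Jacobi morphism $\varphi:\Sigma\to M$, i.e. $\wedge^2T_\sigma\varphi(\pi_\Sigma)=\pi_M|_{\varphi(\sigma)}$ and $T_\sigma\varphi(E_\Sigma)=E_M|_{\varphi(\sigma)}$ for all $\sigma\in\Sigma$. * A *homogeneous Poisson manifold* $(P,\pi_P,Z_P)$ is a Poisson manifold ($[\pi_P,\pi_P]=0$) with a complete vector field $Z_P$ (flow defined for all times in $\mathbb K$) such that $L_{Z_P}\pi_P=-\pi_P$. It is *homogeneous symplectic* if moreover $\pi_P$ is nondegenerate at every point. * A *homogeneous symplectic resolution* of a homogeneous Poisson manifold $(P,\pi_P,Z_P)$ is a homogeneous symplectic manifold $(\widetilde\Sigma,\pi_{\widetilde\Sigma},Z_{\widetilde\Sigma})$ of the same dimension as $P$ with a surjective Poisson morphism $\widetilde\varphi:\widetilde\Sigma\to P$ (that is, $\wedge^2T\widetilde\varphi(\pi_{\widetilde\Sigma})=\pi_P$) such that $T\widetilde\varphi(Z_{\widetilde\Sigma})=Z_P$. * The *Poissonification* of a Jacobi manifold $(M,\pi_M,E_M)$ is the homogeneous Poisson manifold $(P,\pi_P,Z_P)$ with $P=\mathbb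 K\times M$, $Z_P=\partial/\partial t$ and $\pi_P=e^{-t}(\pi_M+Z_P\wedge E_M)$, where $t$ is the coordinate on $\mathbb K$. **Theorem.** Let $n\ge 0$ and let $(M,\pi_M,E_M)$ be a Jacobi manifold of dimension $2n+1$. Then $(M,\pi_M,E_M)$ admits a contact resolution if and only if its Poissonification $(P,\pi_P,Z_P)$ admits a homogeneous symplectic resolution. -/

import Mathlib

open scoped Manifold ContDiff

noncomputable section

namespace JacobiGeometry

/-! Tensor fields on a manifold `M` over `𝕜 = ℝ` or `ℂ`, of class `C^r`. -/

section Tensors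

variable {𝕜 : Type*} [RCLike 𝕜] {E : Type*} [NormedAddCommGroup E] [NormedSpace 𝕜 E]
  {H : Type*} [TopologicalSpace H] (I : ModelWithCorners 𝕜 E H)
  {M : Type*} [TopologicalSpace M] [ChartedSpace H M]

/-- The cotangent space `T*_x M`. -/
abbrev Covector (x : M) : Type _ := TangentSpace I x →L[𝕜] 𝕜

variable (M) in
/-- A (rough) vector field. -/
abbrev VectorField : Type _ := (x : M) → TangentSpace I x

variable (M) in
/-- A (rough) contravariant 2-tensor field, seen as a bilinear form on every cotangent space.
It is a bivector field when all these forms are alternating. -/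
abbrev TwoTensorField : Type _ := (x : M) → LinearMap.BilinForm 𝕜 (Covector I x)

/-- The differential `df` at `x`, as a covector. -/
def diff (f : M → 𝕜) (x : M) : Covector I x := mfderiv I 𝓘(𝕜, 𝕜) f x

variable {I}

/-- The function `X[f] = df(X)`. -/
def VectorField.onFun (X : VectorField I M) (f : M → 𝕜) : M → 𝕜 := fun x => diff I f x (X x)

/-- The function `π(df, dg)`. -/
def TwoTensorField.onFun (π : TwoTensorField I M) (f g : M → 𝕜) : M → 𝕜 :=
  fun x => π x (diff I f x) (diff I g x)

/-- A vector field is of class `C^r` (used for `r = ∞, ω`) when it maps local `C^r` functions to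
local `C^r` functions. -/
def VectorField.IsSmooth (r : WithTop ℕ∞) (X : VectorField I M) : Prop :=
  ∀ (x : M) (f : M → 𝕜), ContMDiffAt I 𝓘(𝕜, 𝕜) r f x → ContMDiffAt I 𝓘(𝕜, 𝕜) r (X.onFun f) x

/-- A 2-tensor field is of class `C^r` (used for `r = ∞, ω`) when `π(df, dg)` is a local `C^r`
function for all local `C^r` functions `f`, `g`. -/
def TwoTensorField.IsSmooth (r : WithTop ℕ∞) (π : TwoTensorField I M) : Prop :=
  ∀ (x : M) (f g : M → 𝕜), ContMDiffAt I 𝓘(𝕜, 𝕜) r f x → ContMDiffAt I 𝓘(𝕜, 𝕜) r g x →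
    ContMDiffAt I 𝓘(𝕜, 𝕜) r (π.onFun f g) x

/-- A vector field is complete when its maximal integral curves are defined for all times
`t ∈ 𝕜` (complex times for holomorphic vector fields). -/
def VectorField.IsComplete (X : VectorField I M) : Prop :=
  ∀ x : M, ∃ γ : 𝕜 → M, γ 0 = x ∧
    ∀ t : 𝕜, HasMFDerivAt 𝓘(𝕜, 𝕜) I γ t ((1 : 𝕜 →L[𝕜] 𝕜).smulRight (X (γ t)))

/-- The value on `(df, dg, dh)` of the Schouten bracket `[π, π]` of a bivector field with itself,
in the sign convention for which `[π, π] = 2 E ∧ π` and `[E, π] = 0` say that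
`{f, g} = π(df, dg) + f E[g] - g E[f]` satisfies the Jacobi identity. -/
def schoutenSelf (π : TwoTensorField I M) (f g h : M → 𝕜) : M → 𝕜 := fun x =>
  2 * (π.onFun (π.onFun f g) h x + π.onFun (π.onFun g h) f x + π.onFun (π.onFun h f) g x)

/-- The value on `(df, dg)` of the Lie derivative `L_X π = [X, π]`. -/
def lieDerivative (X : VectorField I M) (π : TwoTensorField I M) (f g : M → 𝕜) : M → 𝕜 := fun x =>
  X.onFun (π.onFun f g) x - π.onFun (X.onFun f) g x - π.onFun f (X.onFun g) x

/-- The value of the trivector field `X ∧ π` on `(df, dg, dh)`. -/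
def wedge (X : VectorField I M) (π : TwoTensorField I M) (f g h : M → 𝕜) : M → 𝕜 := fun x =>
  X.onFun f x * π.onFun g h x + X.onFun g x * π.onFun h f x + X.onFun h x * π.onFun f g x

/-- The value at `x` of the `(2n+1)`-vector field `X ∧ π ∧ ⋯ ∧ π` (`n` factors `π`) on `2n+1`
covectors, up to a positive constant depending only on `n`. -/
def wedgePow (n : ℕ) (X : VectorField I M) (π : TwoTensorField I M) (x : M)
    (a : Fin (2 * n + 1) → Covector I x) : 𝕜 :=
  ∑ s : Equiv.Perm (Fin (2 * n + 1)), ((Equiv.Perm.sign s : ℤ) : 𝕜) *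
    (a (s ⟨0, by omega⟩) (X x) *
      ∏ i : Fin n, π x (a (s ⟨2 * i + 1, by omega⟩)) (a (s ⟨2 * i + 2, by omega⟩)))

/-- `(π, E)` is a Jacobi structure of class `C^r`: `π` is a bivector field, `E` a vector field,
`[π, π] = 2 E ∧ π` and `[E, π] = 0`. The differentials of local functions span the cotangent
spaces, so that both identities may be tested on them. -/
structure IsJacobi (r : WithTop ℕ∞) (π : TwoTensorField I M) (X : VectorField I M) : Prop where
  alt : ∀ x, (π x).IsAlt
  smooth : π.IsSmooth r
  smooth_vectorField : X.IsSmooth r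
  schouten : ∀ (x : M) (f g h : M → 𝕜), ContMDiffAt I 𝓘(𝕜, 𝕜) r f x →
    ContMDiffAt I 𝓘(𝕜, 𝕜) r g x → ContMDiffAt I 𝓘(𝕜, 𝕜) r h x →
    schoutenSelf π f g h x = 2 * wedge X π f g h x
  lie : ∀ (x : M) (f g : M → 𝕜), ContMDiffAt I 𝓘(𝕜, 𝕜) r f x →
    ContMDiffAt I 𝓘(𝕜, 𝕜) r g x → lieDerivative X π f g x = 0

/-- A contact structure on a manifold of dimension `2n+1`: a Jacobi structure `(π, E)` such that
`E ∧ π^n` vanishes at no point. -/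
structure IsContact (r : WithTop ℕ∞) (n : ℕ) (π : TwoTensorField I M) (X : VectorField I M) :
    Prop extends IsJacobi r π X where
  wedgePow_ne_zero : ∀ x, ∃ a : Fin (2 * n + 1) → Covector I x, wedgePow n X π x a ≠ 0

/-- `π` is a Poisson structure of class `C^r`: a bivector field with `[π, π] = 0`. -/
structure IsPoisson (r : WithTop ℕ∞) (π : TwoTensorField I M) : Prop where
  alt : ∀ x, (π x).IsAlt
  smooth : π.IsSmooth r
  schouten : ∀ (x : M) (f g h : M → 𝕜), ContMDiffAt I 𝓘(𝕜, 𝕜) r f x →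
    ContMDiffAt I 𝓘(𝕜, 𝕜) r g x → ContMDiffAt I 𝓘(𝕜, 𝕜) r h x → schoutenSelf π f g h x = 0

/-- `(π, Z)` is a homogeneous Poisson structure of class `C^r`: `π` is Poisson and `Z` is a complete
vector field with `L_Z π = -π`. -/
structure IsHomogeneousPoisson (r : WithTop ℕ∞) (π : TwoTensorField I M) (Z : VectorField I M) :
    Prop extends IsPoisson r π where
  smooth_vectorField : Z.IsSmooth r
  complete : Z.IsComplete
  homogeneous : ∀ (x : M) (f g : M → 𝕜), ContMDiffAt I 𝓘(𝕜, 𝕜) r f x →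
    ContMDiffAt I 𝓘(𝕜, 𝕜) r g x → lieDerivative Z π f g x = -π.onFun f g x

/-- `(π, Z)` is a homogeneous symplectic structure: a homogeneous Poisson structure whose bivector
field is nondegenerate at every point. -/
structure IsHomogeneousSymplectic (r : WithTop ℕ∞) (π : TwoTensorField I M)
    (Z : VectorField I M) : Prop extends IsHomogeneousPoisson r π Z where
  nondegenerate : ∀ x, (π x).Nondegenerate

variable {E' : Type*} [NormedAddCommGroup E'] [NormedSpace 𝕜 E']
  {H' : Type*} [TopologicalSpace H'] {I' : ModelWithCorners 𝕜 E' H'}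
  {N : Type*} [TopologicalSpace N] [ChartedSpace H' N]

/-- `X` is projectable by `φ`, with projection `Y`: `T_x φ (X_x) = Y_{φ x}`. -/
def VectorField.ProjectsTo (X : VectorField I M) (φ : M → N) (Y : VectorField I' N) : Prop :=
  ∀ x, mfderiv I I' φ x (X x) = Y (φ x)

/-- `π` is projectable by `φ`, with projection `ρ`: `∧² T_x φ (π_x) = ρ_{φ x}`. -/
def TwoTensorField.ProjectsTo (π : TwoTensorField I M) (φ : M → N) (ρ : TwoTensorField I' N) :
    Prop :=
  ∀ (x : M) (α β : Covector I' (φ x)),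
    π x (α.comp (mfderiv I I' φ x)) (β.comp (mfderiv I I' φ x)) = ρ (φ x) α β

/-- The bivector `X ∧ Y` at `x`. -/
def wedgeVectors {x : M} (X Y : TangentSpace I x) : LinearMap.BilinForm 𝕜 (Covector I x) :=
  LinearMap.mk₂ 𝕜 (fun α β => α X * β Y - β X * α Y)
    (by intro a b c; simp only [add_apply]; ring)
    (by intro k a b; simp only [smul_apply, smul_eq_mul]; ring)
    (by intro a b c; simp only [add_apply]; ring)
    (by intro k a b; simp only [smul_apply, smul_eq_mul]; ring)

end Tensors

/-! The Poissonification `P = 𝕜 × M`. The tangent space of `P` at `(t, x)` is `𝕜 × T_x M`. -/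

section Poissonification

variable {𝕜 : Type*} [RCLike 𝕜] {E : Type*} [NormedAddCommGroup E] [NormedSpace 𝕜 E]
  {H : Type*} [TopologicalSpace H] {I : ModelWithCorners 𝕜 E H}
  {M : Type*} [TopologicalSpace M] [ChartedSpace H M]

variable (I) in
/-- Inclusion of `T_x M` in `T_(t,x) (𝕜 × M)`. -/
def tangentIncl (p : 𝕜 × M) : TangentSpace I p.2 →L[𝕜] TangentSpace (𝓘(𝕜, 𝕜).prod I) p :=
  ContinuousLinearMap.inr 𝕜 𝕜 E

variable (I M) in
/-- The vector field `Z_P = ∂/∂t` on `𝕜 × M`. -/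
def poissonificationField : VectorField (𝓘(𝕜, 𝕜).prod I) (𝕜 × M) :=
  fun _ => ((1 : 𝕜), (0 : E))

variable (I) in
/-- Restriction to `T_x M` of a covector of `𝕜 × M` at `(t, x)`. -/
def covectorRestr (p : 𝕜 × M) : Covector (𝓘(𝕜, 𝕜).prod I) p →ₗ[𝕜] Covector I p.2 where
  toFun α := α.comp (tangentIncl I p)
  map_add' _ _ := rfl
  map_smul' _ _ := rfl

/-- The bivector field `π_P = e^{-t} (π + Z_P ∧ X)` on `𝕜 × M`. -/
def poissonification (π : TwoTensorField I M) (X : VectorField I M) :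
    TwoTensorField (𝓘(𝕜, 𝕜).prod I) (𝕜 × M) :=
  fun p => (NormedSpace.exp p.1)⁻¹ •
    ((π p.2).compl₁₂ (covectorRestr I p) (covectorRestr I p)
      + wedgeVectors (poissonificationField I M p) (tangentIncl I p (X p.2)))

end Poissonification

/-! Resolutions. -/

section Resolutions

universe u

variable {𝕜 : Type} [RCLike 𝕜] {E : Type*} [NormedAddCommGroup E] [NormedSpace 𝕜 E]
  {H : Type*} [TopologicalSpace H] {I : ModelWithCorners 𝕜 E H}
  {M : Type u} [TopologicalSpace M] [ChartedSpace H M]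

/-- The Jacobi manifold `(M, π, X)`, of dimension `2n+1`, admits a contact resolution: there are a
contact manifold `S` of dimension `2n+1` and a surjective Jacobi morphism `φ : S → M`. Manifolds
are Hausdorff, but need not be second countable. -/
def AdmitsContactResolution (r : WithTop ℕ∞) (n : ℕ) (π : TwoTensorField I M)
    (X : VectorField I M) : Prop :=
  ∃ (S : Type u) (_ : TopologicalSpace S) (_ : T2Space S)
    (_ : ChartedSpace (EuclideanSpace 𝕜 (Fin (2 * n + 1))) S)
    (_ : IsManifold 𝓘(𝕜, EuclideanSpace 𝕜 (Fin (2 * n + 1))) r S)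
    (πS : TwoTensorField 𝓘(𝕜, EuclideanSpace 𝕜 (Fin (2 * n + 1))) S)
    (XS : VectorField 𝓘(𝕜, EuclideanSpace 𝕜 (Fin (2 * n + 1))) S) (φ : S → M),
    IsContact r n πS XS ∧
    ContMDiff 𝓘(𝕜, EuclideanSpace 𝕜 (Fin (2 * n + 1))) I r φ ∧
    πS.ProjectsTo φ π ∧ XS.ProjectsTo φ X ∧ Function.Surjective φ

/-- The homogeneous Poisson manifold `(M, π, Z)`, of dimension `m`, admits a homogeneous symplectic
resolution: there are a homogeneous symplectic manifold `(S, πS, ZS)` of dimension `m` and a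
surjective Poisson morphism `φ : S → M` by which `ZS` projects to `Z`. -/
def AdmitsHomogeneousSymplecticResolution (r : WithTop ℕ∞) (m : ℕ) (π : TwoTensorField I M)
    (Z : VectorField I M) : Prop :=
  ∃ (S : Type u) (_ : TopologicalSpace S) (_ : T2Space S)
    (_ : ChartedSpace (EuclideanSpace 𝕜 (Fin m)) S)
    (_ : IsManifold 𝓘(𝕜, EuclideanSpace 𝕜 (Fin m)) r S)
    (πS : TwoTensorField 𝓘(𝕜, EuclideanSpace 𝕜 (Fin m)) S)
    (ZS : VectorField 𝓘(𝕜, EuclideanSpace 𝕜 (Fin m)) S) (φ : S → M),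
    IsHomogeneousSymplectic r πS ZS ∧
    ContMDiff 𝓘(𝕜, EuclideanSpace 𝕜 (Fin m)) I r φ ∧
    πS.ProjectsTo φ π ∧ ZS.ProjectsTo φ Z ∧ Function.Surjective φ

end Resolutions

end JacobiGeometry

end

open JacobiGeometry

open scoped Manifold ContDiff Topology
open Set Filter

noncomputable section

namespace JacobiGeometry

/-! ### Differentials of scalar functions -/

section Calculus

variable {𝕜 : Type*} [RCLike 𝕜] {E : Type*} [NormedAddCommGroup E] [NormedSpace 𝕜 E]
  {H : Type*} [TopologicalSpace H] {I : ModelWithCorners 𝕜 E H}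
  {M : Type*} [TopologicalSpace M] [ChartedSpace H M] {x : M} {f g : M → 𝕜}

/-! From contact to symplectic: if `φ : S → M` is a contact resolution, then `id × φ`, from the
Poissonification of `S` to that of `M`, is a homogeneous symplectic resolution. The Poisson and
homogeneity identities are tensorial, so they need checking only on functions `c t + a(x)`: these
include a coordinate system near each point, and their brackets are explicit. In the resulting
expression the part free of the slopes `c` is `[π, π] = 2 E ∧ π`, and the coefficients of the slopes
are `[E, π] = 0` (`IsJacobi.isHomogeneousPoisson`). Nondegeneracy is linear algebra: in dimension
`2n+1`, `E ∧ πⁿ ≠ 0` exactly when `π + ∂ₜ ∧ E` is nondegenerate (`exists_wedgePow_ne_zero_iff`).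

From symplectic to contact: let `φ : N → 𝕜 × M` be a homogeneous symplectic resolution with fields
`π`, `Z`, and put `τ = t ∘ φ`. Since `Z` projects to `∂/∂t`, `Z[τ] = 1`, so `S = {τ = 0}` is a
smooth hypersurface transverse to `Z`. Covectors of `S` are covectors of `N` that kill `Z`; this
restricts `π` to a bivector on `S`, and `π(dτ, ·)` induces the vector field `E`. No quotient by the
flow of `Z` is formed.

To compute brackets on `S`, functions are extended to `N` so that `Z[F]` vanishes on `S` together
with its differential (`IsSlice.exists_flatExtension`). Homogeneity then gives `Z[π(dF, dG)] =
-π(dF, dG)` on `S`, and this failure of invariance produces exactly the term `E ∧ π` in the Jacobi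
identity; `[E, π] = 0` is the Poisson identity for `τ, F, G` (`IsSlice.isJacobi`). The same linear
algebra, read backwards, gives the contact condition (`IsSlice.isContact`). On `S` the factor `e⁻ᵗ`
is 1, so the `M`-component of `φ` restricted to `S` carries the induced structure to the given one;
it is onto because `φ` reaches all of `{0} × M`. -/

theorem diff_congr (h : f =ᶠ[𝓝 x] g) : diff I f x = diff I g x := h.mfderiv_eq

theorem diff_const (c : 𝕜) : diff I (fun _ : M => c) x = 0 := mfderiv_const

theorem diff_add (hf : MDifferentiableAt I 𝓘(𝕜, 𝕜) f x) (hg : MDifferentiableAt I 𝓘(𝕜, 𝕜) g x) :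
    diff I (fun z => f z + g z) x = diff I f x + diff I g x :=
  (hf.hasMFDerivAt.add hg.hasMFDerivAt).mfderiv

theorem diff_mul (hf : MDifferentiableAt I 𝓘(𝕜, 𝕜) f x) (hg : MDifferentiableAt I 𝓘(𝕜, 𝕜) g x) :
    diff I (fun z => f z * g z) x = f x • diff I g x + g x • diff I f x :=
  (hf.hasMFDerivAt.mul hg.hasMFDerivAt).mfderiv

theorem diff_neg : diff I (fun z => - f z) x = - diff I f x := by
  exact mfderiv_neg

theorem diff_sub (hf : MDifferentiableAt I 𝓘(𝕜, 𝕜) f x) (hg : MDifferentiableAt I 𝓘(𝕜, 𝕜) g x) :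
    diff I (fun z => f z - g z) x = diff I f x - diff I g x :=
  (hf.hasMFDerivAt.sub hg.hasMFDerivAt).mfderiv

theorem diff_sum {ι : Type} (s : Finset ι) (F : ι → M → 𝕜)
    (hF : ∀ i, MDifferentiableAt I 𝓘(𝕜, 𝕜) (F i) x) :
    diff I (fun z => ∑ i ∈ s, F i z) x = ∑ i ∈ s, diff I (F i) x := by
  have h := (HasMFDerivAt.sum (t := s) fun i _ => (hF i).hasMFDerivAt).mfderiv
  have e : (fun z => ∑ i ∈ s, F i z) = ∑ i ∈ s, F i := by ext z; simp
  rw [e]; exact h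

theorem diff_sum_mul {ι : Type} [Fintype ι] {c u : ι → M → 𝕜}
    (hc : ∀ i, MDifferentiableAt I 𝓘(𝕜, 𝕜) (c i) x)
    (hu : ∀ i, MDifferentiableAt I 𝓘(𝕜, 𝕜) (u i) x) :
    diff I (fun z => ∑ i, c i z * u i z) x =
      ∑ i, (c i x • diff I (u i) x + u i x • diff I (c i) x) := by
  rw [diff_sum _ (fun i z => c i z * u i z) fun i => (hc i).mul (hu i)]
  exact Finset.sum_congr rfl fun i _ => diff_mul (hc i) (hu i)

theorem ContMDiffAt.eventually_mdifferentiableAt [IsManifold I 1 M] {r : WithTop ℕ∞} (hr : 1 ≤ r)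
    {E' H' : Type*} [NormedAddCommGroup E'] [NormedSpace 𝕜 E'] [TopologicalSpace H']
    {I' : ModelWithCorners 𝕜 E' H'} {N : Type*} [TopologicalSpace N] [ChartedSpace H' N]
    [IsManifold I' 1 N] {f : M → N}
    (hf : ContMDiffAt I I' r f x) : ∀ᶠ z in 𝓝 x, MDifferentiableAt I I' f z :=
  ((contMDiffAt_iff_contMDiffAt_nhds (by simp)).1 (hf.of_le hr)).mono fun _ h => h.mdifferentiableAt one_ne_zero

end Calculus

/-! Local frames of exact 1-forms. -/

section Frames

variable {𝕜 : Type*} [RCLike 𝕜] {E : Type*} [NormedAddCommGroup E] [NormedSpace 𝕜 E]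
  {H : Type*} [TopologicalSpace H] {I : ModelWithCorners 𝕜 E H}
  {M : Type*} [TopologicalSpace M] [ChartedSpace H M]

variable (I) in
/-- Near `x`, the differential of every `C^r` function is a combination with `C^r` coefficients
of the differentials of the functions `y i`. The field `symm` expresses `d (df) = 0` at `x`. -/
structure IsCoordinateSystemAt (r : WithTop ℕ∞) {ι : Type} [Fintype ι] (y : ι → M → 𝕜) (x : M) :
    Prop where
  smooth : ∀ i, ContMDiffAt I 𝓘(𝕜, 𝕜) r (y i) x
  exists_coeff : ∀ f : M → 𝕜, ContMDiffAt I 𝓘(𝕜, 𝕜) r f x → ∃ c : ι → M → 𝕜,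
    (∀ i, ContMDiffAt I 𝓘(𝕜, 𝕜) r (c i) x) ∧
    (∀ᶠ z in 𝓝 x, diff I f z = ∑ i, c i z • diff I (y i) z) ∧
    ∀ v w : TangentSpace I x, ∑ i, diff I (c i) x v * diff I (y i) x w =
      ∑ i, diff I (c i) x w * diff I (y i) x v

/-- Differentiation loses no regularity in the smooth and analytic classes, so the coefficients of
`df` in a frame are again of class `C^r`. -/
theorem add_one_le_of_eq {r : WithTop ℕ∞} (hr : r = ∞ ∨ r = ω) : r + 1 ≤ r := by
  rcases hr with rfl | rfl <;> simp

theorem two_le_of_eq {r : WithTop ℕ∞} (hr : r = ∞ ∨ r = ω) : 2 ≤ r := by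
  rcases hr with rfl | rfl
  · exact WithTop.coe_le_coe.2 (le_top : (2 : ℕ∞) ≤ ⊤)
  · exact le_top

theorem one_le_of_eq {r : WithTop ℕ∞} (hr : r = ∞ ∨ r = ω) : 1 ≤ r :=
  le_trans (by norm_num) (two_le_of_eq hr)

/-- The coefficients are the partial derivatives of `f ∘ ψ⁻¹`, evaluated at `ψ z`. The symmetry
condition on them is the symmetry of the second derivative of `f ∘ ψ⁻¹`. -/
theorem isCoordinateSystemAt_extChartAt [I.Boundaryless] {r : WithTop ℕ∞} (hr : r = ∞ ∨ r = ω)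
    [IsManifold I r M] {ι : Type} [Fintype ι] (b : Module.Basis ι 𝕜 E) (x : M) :
    IsCoordinateSystemAt I r (fun i (z : M) => b.repr (extChartAt I x z) i) x := by
  classical
  have : FiniteDimensional 𝕜 E := b.finiteDimensional_of_finite
  have h1 := one_le_of_eq hr
  have : IsManifold I 1 M := .of_le h1
  set ψ := extChartAt I x with hψ
  have hψs : ContMDiffAt I 𝓘(𝕜, E) r ψ x := contMDiffAt_extChartAt
  have hψd := ContMDiffAt.eventually_mdifferentiableAt h1 hψs
  let l : ι → E →L[𝕜] 𝕜 := fun i => LinearMap.toContinuousLinearMap (b.coord i)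
  have hl : ∀ i v, l i v = b.repr v i := fun i v => rfl
  have hy : ∀ i z, MDifferentiableAt I 𝓘(𝕜, E) ψ z →
      diff I (fun z : M => b.repr (ψ z) i) z = (l i).comp (mfderiv I 𝓘(𝕜, E) ψ z) := by
    intro i z hz
    have h := (l i).hasMFDerivAt (x := ψ z)
    exact (h.comp z hz.hasMFDerivAt).mfderiv
  refine ⟨fun i => ?_, fun f hf => ?_⟩
  · have : ContMDiff 𝓘(𝕜, E) 𝓘(𝕜, 𝕜) r (l i) := (l i).contMDiff
    exact this.contMDiffAt.comp x hψs
  · have hf' : ContDiffAt 𝕜 r (f ∘ ψ.symm) (ψ x) := by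
      have := (contMDiffAt_iff.1 hf).2
      rw [I.range_eq_univ, contDiffWithinAt_univ] at this
      exact this
    have hF : ContDiffAt 𝕜 r (fderiv 𝕜 (f ∘ ψ.symm)) (ψ x) :=
      hf'.fderiv_right (add_one_le_of_eq hr)
    have hFM : ContMDiffAt I 𝓘(𝕜, E →L[𝕜] 𝕜) r (fun z => fderiv 𝕜 (f ∘ ψ.symm) (ψ z)) x :=
      hF.contMDiffAt.comp x hψs
    refine ⟨fun i z => fderiv 𝕜 (f ∘ ψ.symm) (ψ z) (b i), fun i => ?_, ?_, fun v w => ?_⟩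
    · let ev : (E →L[𝕜] 𝕜) →L[𝕜] 𝕜 := ContinuousLinearMap.apply 𝕜 𝕜 (b i)
      exact ev.contMDiff.contMDiffAt.comp x hFM
    · have hfd : ∀ᶠ w in 𝓝 (ψ x), DifferentiableAt 𝕜 (f ∘ ψ.symm) w :=
        ((hf'.of_le h1).eventually (by simp)).mono fun _ h => h.differentiableAt one_ne_zero
      filter_upwards [hψd, hψs.continuousAt.eventually hfd,
        eventually_eventually_nhds.2 (extChartAt_source_mem_nhds (I := I) x)] with z hz hfz hsz
      have e : f =ᶠ[𝓝 z] (f ∘ ψ.symm) ∘ ψ := by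
        filter_upwards [hsz] with w hw
        simp only [Function.comp_apply]
        rw [ψ.left_inv hw]
      rw [diff_congr e]
      have h2 : diff I ((f ∘ ψ.symm) ∘ ψ) z = (fderiv 𝕜 (f ∘ ψ.symm) (ψ z)).comp
          (mfderiv I 𝓘(𝕜, E) ψ z) :=
        (hfz.hasFDerivAt.hasMFDerivAt.comp z hz.hasMFDerivAt).mfderiv
      rw [h2]
      ext v
      have h3 : ∀ i, diff I (fun z : M => b.repr (ψ z) i) z v =
        b.repr (mfderiv I 𝓘(𝕜, E) ψ z v) i := fun i => by rw [hy i z hz]; rfl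
      rw [sum_apply]
      simp only [smul_apply, h3, smul_eq_mul]
      change fderiv 𝕜 (f ∘ ψ.symm) (ψ z) (mfderiv I 𝓘(𝕜, E) ψ z v) = _
      conv_lhs => rw [← b.sum_repr (mfderiv I 𝓘(𝕜, E) ψ z v)]
      rw [map_sum]
      exact Finset.sum_congr rfl fun i _ => by rw [map_smul, smul_eq_mul, mul_comm]
    · have hψx := hψd.self_of_nhds
      have hFd : DifferentiableAt 𝕜 (fderiv 𝕜 (f ∘ ψ.symm)) (ψ x) :=
        hF.differentiableAt (by rintro rfl; simp at h1)
      have hsym : IsSymmSndFDerivAt 𝕜 (f ∘ ψ.symm) (ψ x) :=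
        hf'.isSymmSndFDerivAt (by simpa using two_le_of_eq hr)
      have hc : ∀ i v, diff I (fun z => fderiv 𝕜 (f ∘ ψ.symm) (ψ z) (b i)) x v =
          fderiv 𝕜 (fderiv 𝕜 (f ∘ ψ.symm)) (ψ x) (mfderiv I 𝓘(𝕜, E) ψ x v) (b i) := by
        intro i v
        let ev : (E →L[𝕜] 𝕜) →L[𝕜] 𝕜 := ContinuousLinearMap.apply 𝕜 𝕜 (b i)
        have h := (ev.hasMFDerivAt.comp (ψ x) hFd.hasFDerivAt.hasMFDerivAt).comp x
          hψx.hasMFDerivAt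
        exact congrArg (fun L : TangentSpace I x →L[𝕜] 𝕜 => L v) h.mfderiv
      have key : ∀ v w, ∑ i, diff I (fun z => fderiv 𝕜 (f ∘ ψ.symm) (ψ z) (b i)) x v *
          diff I (fun z : M => b.repr (ψ z) i) x w =
          fderiv 𝕜 (fderiv 𝕜 (f ∘ ψ.symm)) (ψ x) (mfderiv I 𝓘(𝕜, E) ψ x v)
            (mfderiv I 𝓘(𝕜, E) ψ x w) := by
        intro v w
        have h3 : ∀ i, diff I (fun z : M => b.repr (ψ z) i) x w =
          b.repr (mfderiv I 𝓘(𝕜, E) ψ x w) i := fun i => by rw [hy i x hψx]; rfl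
        conv_rhs => rw [← b.sum_repr (mfderiv I 𝓘(𝕜, E) ψ x w)]
        rw [map_sum]
        exact Finset.sum_congr rfl fun i _ => by
          rw [map_smul, smul_eq_mul, mul_comm, hc, h3]
      rw [key, key]
      exact hsym _ _

end Frames

/-! ### Tensoriality of the Schouten bracket and of the Lie derivative -/

section Tensoriality

variable {𝕜 : Type*} [RCLike 𝕜] {E : Type*} [NormedAddCommGroup E] [NormedSpace 𝕜 E]
  {H : Type*} [TopologicalSpace H] {I : ModelWithCorners 𝕜 E H}
  {M : Type*} [TopologicalSpace M] [ChartedSpace H M] {x : M}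

/-- Reflexivity in finite dimension. It turns `π(·, dg)` into an actual vector, on which
differentials can be evaluated. -/
theorem exists_tangentVector [FiniteDimensional 𝕜 E] (L : Covector I x →ₗ[𝕜] 𝕜) :
    ∃ v : TangentSpace I x, ∀ α : Covector I x, α v = L α := by
  let e : Module.Dual 𝕜 E ≃ₗ[𝕜] (E →L[𝕜] 𝕜) := LinearMap.toContinuousLinearMap
  obtain ⟨v, hv⟩ := (Module.evalEquiv 𝕜 E).surjective (L.comp e.toLinearMap)
  refine ⟨v, fun α => ?_⟩
  have := congrArg (fun T : Module.Dual 𝕜 (Module.Dual 𝕜 E) => T (e.symm α)) hv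
  have h2 : e (e.symm α) = α := e.apply_symm_apply α
  change (e.symm α) v = L (e (e.symm α)) at this
  rw [h2] at this
  exact this

theorem TwoTensorField.onFun_swap {π : TwoTensorField I M} (hπ : ∀ x, (π x).IsAlt) (f g : M → 𝕜) :
    π.onFun f g = fun z => - π.onFun g f z := by
  funext z
  exact ((hπ z).neg_eq _ _).symm

theorem TwoTensorField.onFun_congr (π : TwoTensorField I M) {f f' g g' : M → 𝕜}
    (hf : f =ᶠ[𝓝 x] f') (hg : g =ᶠ[𝓝 x] g') : π.onFun f g x = π.onFun f' g' x := by
  simp only [TwoTensorField.onFun, diff_congr hf, diff_congr hg]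

theorem VectorField.onFun_congr (X : VectorField I M) {f f' : M → 𝕜} (hf : f =ᶠ[𝓝 x] f') :
    X.onFun f x = X.onFun f' x := by
  simp only [VectorField.onFun, diff_congr hf]

theorem schoutenSelf_rotate (π : TwoTensorField I M) (f g h : M → 𝕜) :
    schoutenSelf π f g h x = schoutenSelf π g h f x := by
  simp only [schoutenSelf]; ring

theorem lieDerivative_swap {π : TwoTensorField I M} (hπ : ∀ x, (π x).IsAlt) (Z : VectorField I M) (f g : M → 𝕜) :
    lieDerivative Z π f g x = - lieDerivative Z π g f x := by
  have h : Z.onFun (π.onFun f g) x = - Z.onFun (π.onFun g f) x := by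
    rw [TwoTensorField.onFun_swap hπ f g]
    simp only [VectorField.onFun]
    rw [diff_neg]
    rfl
  simp only [lieDerivative]
  rw [h, TwoTensorField.onFun_swap hπ f, TwoTensorField.onFun_swap hπ _ g]
  ring

variable {r : WithTop ℕ∞} {ι : Type} [Fintype ι] {y : ι → M → 𝕜}

/-- The expansion of `df` is an identity of covectors near `x`, so it passes through any bilinear or
linear field and for any second function `g`, with the same coefficients throughout. -/
theorem IsCoordinateSystemAt.exists_onFun (hy : IsCoordinateSystemAt I r y x)
    {f : M → 𝕜} (hf : ContMDiffAt I 𝓘(𝕜, 𝕜) r f x) : ∃ c : ι → M → 𝕜,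
    (∀ i, ContMDiffAt I 𝓘(𝕜, 𝕜) r (c i) x) ∧
    (diff I f x = ∑ i, c i x • diff I (y i) x) ∧
    (∀ (π : TwoTensorField I M) (g : M → 𝕜),
      π.onFun f g =ᶠ[𝓝 x] fun z => ∑ i, c i z * π.onFun (y i) g z) ∧
    (∀ (π : TwoTensorField I M) (g : M → 𝕜),
      π.onFun g f =ᶠ[𝓝 x] fun z => ∑ i, c i z * π.onFun g (y i) z) ∧
    (∀ (X : VectorField I M), X.onFun f =ᶠ[𝓝 x] fun z => ∑ i, c i z * X.onFun (y i) z) ∧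
    ∀ v w : TangentSpace I x, ∑ i, diff I (c i) x v * diff I (y i) x w =
      ∑ i, diff I (c i) x w * diff I (y i) x v := by
  obtain ⟨c, hc, h, hs⟩ := hy.exists_coeff f hf
  refine ⟨c, hc, h.self_of_nhds, fun π g => ?_, fun π g => ?_, fun X => ?_, hs⟩
  · filter_upwards [h] with z hz
    simp only [TwoTensorField.onFun, hz, map_sum, LinearMap.sum_apply, map_smul,
      LinearMap.smul_apply, smul_eq_mul]
  · filter_upwards [h] with z hz
    simp only [TwoTensorField.onFun, hz, map_sum, map_smul, smul_eq_mul]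
  · filter_upwards [h] with z hz
    simp only [VectorField.onFun, hz]
    rw [sum_apply]
    rfl

theorem contMDiffAt_sum_mul {c u : ι → M → 𝕜} (hc : ∀ i, ContMDiffAt I 𝓘(𝕜, 𝕜) r (c i) x)
    (hu : ∀ i, ContMDiffAt I 𝓘(𝕜, 𝕜) r (u i) x) :
    ContMDiffAt I 𝓘(𝕜, 𝕜) r (fun z => ∑ i, c i z * u i z) x := by
  have h : ∀ i, ContMDiffAt I 𝓘(𝕜, 𝕜) r (fun z => c i z * u i z) x := fun i =>
    (contDiff_mul (𝔸 := 𝕜)).contMDiff.contMDiffAt.comp x ((hc i).prodMk_space (hu i))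
  exact contMDiffAt_finsetSum fun i _ => h i

theorem IsCoordinateSystemAt.contMDiffAt_onFun (hy : IsCoordinateSystemAt I r y x)
    {π : TwoTensorField I M}
    (h : ∀ i j, ContMDiffAt I 𝓘(𝕜, 𝕜) r (π.onFun (y i) (y j)) x) {f g : M → 𝕜}
    (hf : ContMDiffAt I 𝓘(𝕜, 𝕜) r f x) (hg : ContMDiffAt I 𝓘(𝕜, 𝕜) r g x) :
    ContMDiffAt I 𝓘(𝕜, 𝕜) r (π.onFun f g) x := by
  obtain ⟨c, hc, -, h1, -⟩ := hy.exists_onFun hf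
  obtain ⟨d, hd, -, -, h2, -⟩ := hy.exists_onFun hg
  refine (contMDiffAt_sum_mul hc fun i => ?_).congr_of_eventuallyEq (h1 π g)
  exact (contMDiffAt_sum_mul hd fun j => h i j).congr_of_eventuallyEq (h2 π (y i))

theorem IsCoordinateSystemAt.contMDiffAt_vectorField (hy : IsCoordinateSystemAt I r y x)
    {X : VectorField I M} (h : ∀ i, ContMDiffAt I 𝓘(𝕜, 𝕜) r (X.onFun (y i)) x) {f : M → 𝕜}
    (hf : ContMDiffAt I 𝓘(𝕜, 𝕜) r f x) : ContMDiffAt I 𝓘(𝕜, 𝕜) r (X.onFun f) x := by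
  obtain ⟨c, hc, -, -, -, h1, -⟩ := hy.exists_onFun hf
  exact (contMDiffAt_sum_mul hc h).congr_of_eventuallyEq (h1 X)

variable [FiniteDimensional 𝕜 E] {π : TwoTensorField I M}

/-- With `df = ∑ cᵢ dyᵢ`, the bracket is `∑ cᵢ` times the bracket of `yᵢ, g, h`, plus terms in the
derivatives of the `cᵢ`. Those add up to `∑ dcᵢ ∧ dyᵢ` evaluated on the vectors `V = π(·, dg)` and
`W = π(·, dh)`, which is zero because `d(df) = 0`. -/
theorem IsCoordinateSystemAt.schoutenSelf_eq_zero_of_left (hy : IsCoordinateSystemAt I r y x)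
    (hr : 1 ≤ r) (hπ : ∀ x, (π x).IsAlt)
    (hs : ∀ f g : M → 𝕜, ContMDiffAt I 𝓘(𝕜, 𝕜) r f x → ContMDiffAt I 𝓘(𝕜, 𝕜) r g x →
      ContMDiffAt I 𝓘(𝕜, 𝕜) r (π.onFun f g) x) {f g h : M → 𝕜}
    (hf : ContMDiffAt I 𝓘(𝕜, 𝕜) r f x) (hg : ContMDiffAt I 𝓘(𝕜, 𝕜) r g x)
    (hh : ContMDiffAt I 𝓘(𝕜, 𝕜) r h x) (H : ∀ i, schoutenSelf π (y i) g h x = 0) :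
    schoutenSelf π f g h x = 0 := by
  obtain ⟨c, hc, h0, h1, h2, -, hsym⟩ := hy.exists_onFun hf
  have hr0 : r ≠ 0 := by rintro rfl; simp at hr
  have md : ∀ {u : M → 𝕜}, ContMDiffAt I 𝓘(𝕜, 𝕜) r u x → MDifferentiableAt I 𝓘(𝕜, 𝕜) u x :=
    fun hu => hu.mdifferentiableAt hr0
  obtain ⟨V, hV⟩ := exists_tangentVector ((π x).flip (diff I g x))
  obtain ⟨W, hW⟩ := exists_tangentVector ((π x).flip (diff I h x))
  have d1 : diff I (π.onFun f g) x = ∑ i, (c i x • diff I (π.onFun (y i) g) x +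
      π.onFun (y i) g x • diff I (c i) x) := by
    rw [diff_congr (h1 π g), diff_sum_mul (fun i => md (hc i)) fun i => md (hs _ _ (hy.smooth i) hg)]
  have d3 : diff I (π.onFun h f) x = ∑ i, (c i x • diff I (π.onFun h (y i)) x +
      π.onFun h (y i) x • diff I (c i) x) := by
    rw [diff_congr (h2 π h), diff_sum_mul (fun i => md (hc i)) fun i => md (hs _ _ hh (hy.smooth i))]
  have e1 : π.onFun (π.onFun f g) h x = ∑ i, (c i x * π.onFun (π.onFun (y i) g) h x +
      diff I (y i) x V * diff I (c i) x W) := by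
    have : ∀ i, π.onFun (y i) g x = diff I (y i) x V := fun i => (hV _).symm
    have h' : ∀ i, (π x (diff I (c i) x)) (diff I h x) = diff I (c i) x W := fun i => (hW _).symm
    simp only [TwoTensorField.onFun, d1] at this ⊢
    simp only [map_sum, map_add, map_smul, LinearMap.sum_apply, LinearMap.add_apply,
      LinearMap.smul_apply, smul_eq_mul, this, h']
  have e3 : π.onFun (π.onFun h f) g x = ∑ i, (c i x * π.onFun (π.onFun h (y i)) g x -
      diff I (y i) x W * diff I (c i) x V) := by
    have : ∀ i, π.onFun h (y i) x = - diff I (y i) x W := fun i => by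
      rw [hW]; exact ((hπ x).neg_eq _ _).symm
    have h' : ∀ i, (π x (diff I (c i) x)) (diff I g x) = diff I (c i) x V := fun i => (hV _).symm
    simp only [TwoTensorField.onFun, d3] at this ⊢
    simp only [map_sum, map_add, map_smul, LinearMap.sum_apply, LinearMap.add_apply,
      LinearMap.smul_apply, smul_eq_mul, this, h', neg_mul, sub_eq_add_neg]
  have e2 : π.onFun (π.onFun g h) f x = ∑ i, c i x * π.onFun (π.onFun g h) (y i) x :=
    (h2 π _).self_of_nhds
  have key : schoutenSelf π f g h x = ∑ i, c i x * schoutenSelf π (y i) g h x := by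
    have h3 := hsym V W
    simp only [schoutenSelf]
    rw [e1, e2, e3]
    have h4 : ∑ i, diff I (y i) x V * diff I (c i) x W = ∑ i, diff I (y i) x W * diff I (c i) x V :=
      by simpa only [mul_comm] using h3.symm
    simp only [Finset.sum_add_distrib, Finset.sum_sub_distrib, h4]
    simp only [mul_add, ← Finset.mul_sum, Finset.sum_add_distrib, mul_left_comm _ (2 : 𝕜)]
    ring
  rw [key]
  simp [H]

theorem IsCoordinateSystemAt.schoutenSelf_eq_zero (hy : IsCoordinateSystemAt I r y x)
    (hr : 1 ≤ r) (hπ : ∀ x, (π x).IsAlt)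
    (hs : ∀ f g : M → 𝕜, ContMDiffAt I 𝓘(𝕜, 𝕜) r f x → ContMDiffAt I 𝓘(𝕜, 𝕜) r g x →
      ContMDiffAt I 𝓘(𝕜, 𝕜) r (π.onFun f g) x) {f g h : M → 𝕜}
    (hf : ContMDiffAt I 𝓘(𝕜, 𝕜) r f x) (hg : ContMDiffAt I 𝓘(𝕜, 𝕜) r g x)
    (hh : ContMDiffAt I 𝓘(𝕜, 𝕜) r h x)
    (H : ∀ i j k, schoutenSelf π (y i) (y j) (y k) x = 0) :
    schoutenSelf π f g h x = 0 := by
  refine hy.schoutenSelf_eq_zero_of_left hr hπ hs hf hg hh fun i => ?_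
  rw [schoutenSelf_rotate]
  refine hy.schoutenSelf_eq_zero_of_left hr hπ hs hg hh (hy.smooth i) fun j => ?_
  rw [schoutenSelf_rotate]
  refine hy.schoutenSelf_eq_zero_of_left hr hπ hs hh (hy.smooth i) (hy.smooth j) fun k => ?_
  exact H k i j

/-- As for the Schouten bracket, the derivatives of the coefficients enter only through `∑ dcᵢ ∧
dyᵢ`, here evaluated on `π(·, dg)` and `Z`. -/
theorem IsCoordinateSystemAt.lieDerivative_eq_neg_of_left (hy : IsCoordinateSystemAt I r y x)
    (hr : 1 ≤ r) {Z : VectorField I M}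
    (hs : ∀ f g : M → 𝕜, ContMDiffAt I 𝓘(𝕜, 𝕜) r f x → ContMDiffAt I 𝓘(𝕜, 𝕜) r g x →
      ContMDiffAt I 𝓘(𝕜, 𝕜) r (π.onFun f g) x)
    (hZ : ∀ f : M → 𝕜, ContMDiffAt I 𝓘(𝕜, 𝕜) r f x → ContMDiffAt I 𝓘(𝕜, 𝕜) r (Z.onFun f) x)
    {f g : M → 𝕜} (hf : ContMDiffAt I 𝓘(𝕜, 𝕜) r f x) (hg : ContMDiffAt I 𝓘(𝕜, 𝕜) r g x)
    (H : ∀ i, lieDerivative Z π (y i) g x = - π.onFun (y i) g x) :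
    lieDerivative Z π f g x = - π.onFun f g x := by
  obtain ⟨c, hc, h0, h1, h2, h3, hsym⟩ := hy.exists_onFun hf
  have hr0 : r ≠ 0 := by rintro rfl; simp at hr
  have md : ∀ {u : M → 𝕜}, ContMDiffAt I 𝓘(𝕜, 𝕜) r u x → MDifferentiableAt I 𝓘(𝕜, 𝕜) u x :=
    fun hu => hu.mdifferentiableAt hr0
  obtain ⟨V, hV⟩ := exists_tangentVector ((π x).flip (diff I g x))
  have d1 : diff I (π.onFun f g) x = ∑ i, (c i x • diff I (π.onFun (y i) g) x +
      π.onFun (y i) g x • diff I (c i) x) := by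
    rw [diff_congr (h1 π g), diff_sum_mul (fun i => md (hc i)) fun i => md (hs _ _ (hy.smooth i) hg)]
  have d2 : diff I (Z.onFun f) x = ∑ i, (c i x • diff I (Z.onFun (y i)) x +
      Z.onFun (y i) x • diff I (c i) x) := by
    rw [diff_congr (h3 Z), diff_sum_mul (fun i => md (hc i)) fun i => md (hZ _ (hy.smooth i))]
  have e1 : Z.onFun (π.onFun f g) x = ∑ i, (c i x * Z.onFun (π.onFun (y i) g) x +
      diff I (y i) x V * diff I (c i) x (Z x)) := by
    have : ∀ i, π.onFun (y i) g x = diff I (y i) x V := fun i => (hV _).symm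
    simp only [this] at d1
    simp only [VectorField.onFun, d1]
    rw [sum_apply]
    rfl
  have e2 : π.onFun (Z.onFun f) g x = ∑ i, (c i x * π.onFun (Z.onFun (y i)) g x +
      diff I (y i) x (Z x) * diff I (c i) x V) := by
    have h' : ∀ i, (π x (diff I (c i) x)) (diff I g x) = diff I (c i) x V := fun i => (hV _).symm
    simp only [TwoTensorField.onFun, d2]
    simp only [map_sum, map_add, map_smul, LinearMap.sum_apply, LinearMap.add_apply,
      LinearMap.smul_apply, smul_eq_mul, h', VectorField.onFun]
  have key : lieDerivative Z π f g x = ∑ i, c i x * lieDerivative Z π (y i) g x := by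
    have h3 := hsym V (Z x)
    simp only [lieDerivative]
    rw [e1, e2, (h1 π (Z.onFun g)).self_of_nhds]
    have h4 : ∑ i, diff I (y i) x V * diff I (c i) x (Z x) =
      ∑ i, diff I (y i) x (Z x) * diff I (c i) x V := by simpa only [mul_comm] using h3.symm
    simp only [mul_sub, Finset.sum_add_distrib, Finset.sum_sub_distrib, h4]
    ring
  rw [key, (h1 π g).self_of_nhds]
  simp [H]

theorem IsCoordinateSystemAt.lieDerivative_eq_neg (hy : IsCoordinateSystemAt I r y x)
    (hr : 1 ≤ r) {Z : VectorField I M} (hπ : ∀ x, (π x).IsAlt)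
    (hs : ∀ f g : M → 𝕜, ContMDiffAt I 𝓘(𝕜, 𝕜) r f x → ContMDiffAt I 𝓘(𝕜, 𝕜) r g x →
      ContMDiffAt I 𝓘(𝕜, 𝕜) r (π.onFun f g) x)
    (hZ : ∀ f : M → 𝕜, ContMDiffAt I 𝓘(𝕜, 𝕜) r f x → ContMDiffAt I 𝓘(𝕜, 𝕜) r (Z.onFun f) x)
    {f g : M → 𝕜} (hf : ContMDiffAt I 𝓘(𝕜, 𝕜) r f x) (hg : ContMDiffAt I 𝓘(𝕜, 𝕜) r g x)
    (H : ∀ i j, lieDerivative Z π (y i) (y j) x = - π.onFun (y i) (y j) x) :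
    lieDerivative Z π f g x = - π.onFun f g x := by
  refine hy.lieDerivative_eq_neg_of_left hr hs hZ hf hg fun i => ?_
  rw [lieDerivative_swap hπ, TwoTensorField.onFun_swap hπ (y i),
    hy.lieDerivative_eq_neg_of_left hr hs hZ hg (hy.smooth i) fun j => H j i]

end Tensoriality

/-! ### The function `e⁻ᵗ` -/

section Exponential

variable {𝕜 : Type*} [RCLike 𝕜]

theorem exp_inv_ne_zero (t : 𝕜) : (NormedSpace.exp t)⁻¹ ≠ 0 :=
  inv_ne_zero (NormedSpace.isUnit_exp t).ne_zero

theorem hasDerivAt_exp_inv (t : 𝕜) :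
    HasDerivAt (fun s : 𝕜 => (NormedSpace.exp s)⁻¹) (-(NormedSpace.exp t)⁻¹) t := by
  have h0 : NormedSpace.exp t ≠ 0 := (NormedSpace.isUnit_exp t).ne_zero
  have h := (hasDerivAt_exp (𝕂 := 𝕜) (x := t)).inv h0
  convert! h using 1
  field_simp

theorem contDiff_exp_inv {r : WithTop ℕ∞} : ContDiff 𝕜 r fun s : 𝕜 => (NormedSpace.exp s)⁻¹ :=
  contDiff_iff_contDiffAt.2 fun t =>
    ((NormedSpace.exp_analytic (𝕂 := 𝕜) t).contDiffAt).inv (NormedSpace.isUnit_exp t).ne_zero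

end Exponential

/-! ### The Poissonification is homogeneous Poisson -/

section Poissonification

variable {𝕜 : Type*} [RCLike 𝕜] {E : Type*} [NormedAddCommGroup E] [NormedSpace 𝕜 E]
  {H : Type*} [TopologicalSpace H] {I : ModelWithCorners 𝕜 E H}
  {M : Type*} [TopologicalSpace M] [ChartedSpace H M]

variable (I) in
/-- The covector `s dt + α` of `𝕜 × M`. -/
def prodCovector (p : 𝕜 × M) (s : 𝕜) (α : Covector I p.2) : Covector (𝓘(𝕜, 𝕜).prod I) p :=
  s • ContinuousLinearMap.fst 𝕜 𝕜 E + ContinuousLinearMap.comp (show E →L[𝕜] 𝕜 from α) (ContinuousLinearMap.snd 𝕜 𝕜 E)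

theorem prodCovector_apply (p : 𝕜 × M) (s : 𝕜) (α : Covector I p.2)
    (v : TangentSpace (𝓘(𝕜, 𝕜).prod I) p) :
    prodCovector I p s α v = s * v.1 + α v.2 := rfl

theorem prodCovector_field (p : 𝕜 × M) (s : 𝕜) (α : Covector I p.2) :
    prodCovector I p s α (poissonificationField I M p) = s := by
  rw [prodCovector_apply]
  change s * 1 + α 0 = s
  rw [map_zero, mul_one, add_zero]

theorem prodCovector_tangentIncl (p : 𝕜 × M) (s : 𝕜) (α : Covector I p.2)
    (v : TangentSpace I p.2) : prodCovector I p s α (tangentIncl I p v) = α v := by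
  rw [prodCovector_apply]
  change s * 0 + α v = α v
  rw [mul_zero, zero_add]

theorem covectorRestr_prodCovector (p : 𝕜 × M) (s : 𝕜) (α : Covector I p.2) :
    covectorRestr I p (prodCovector I p s α) = α := by
  ext v
  exact prodCovector_tangentIncl p s α v

theorem eq_prodCovector (p : 𝕜 × M) (γ : Covector (𝓘(𝕜, 𝕜).prod I) p) :
    γ = prodCovector I p (γ (poissonificationField I M p)) (covectorRestr I p γ) := by
  ext v
  rw [prodCovector_apply]
  have hv : v = v.1 • (poissonificationField I M p) + tangentIncl I p v.2 := by
    change (v : 𝕜 × E) = v.1 • ((1 : 𝕜), (0 : E)) + ((0 : 𝕜), v.2)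
    exact Prod.ext (by simp) (by simp)
  conv_lhs => rw [hv]
  rw [map_add, map_smul, smul_eq_mul, mul_comm]
  rfl

/-- Every covector of `𝕜 × M` has the form `s dt + α` by `eq_prodCovector`, so this formula
determines `π_P` completely and replaces its definition from here on. -/
theorem poissonification_prodCovector (π : TwoTensorField I M) (X : VectorField I M)
    (p : 𝕜 × M) (s t : 𝕜) (α β : Covector I p.2) :
    poissonification π X p (prodCovector I p s α) (prodCovector I p t β) =
      (NormedSpace.exp p.1)⁻¹ * (π p.2 α β + s * β (X p.2) - t * α (X p.2)) := by
  simp only [poissonification, LinearMap.smul_apply, LinearMap.add_apply, LinearMap.compl₁₂_apply,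
    covectorRestr_prodCovector, smul_eq_mul, wedgeVectors, LinearMap.mk₂_apply,
    prodCovector_field, prodCovector_tangentIncl]
  ring

theorem diff_fst_snd {φ : 𝕜 → 𝕜} {φ' : 𝕜} {a : M → 𝕜} {p : 𝕜 × M} (hφ : HasDerivAt φ φ' p.1)
    (ha : MDifferentiableAt I 𝓘(𝕜, 𝕜) a p.2) (c : 𝕜) :
    diff (𝓘(𝕜, 𝕜).prod I) (fun q : 𝕜 × M => c * q.1 + φ q.1 * a q.2) p =
      prodCovector I p (c + a p.2 * φ') (φ p.1 • diff I a p.2) := by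
  have h1 : HasMFDerivAt (𝓘(𝕜, 𝕜).prod I) 𝓘(𝕜, 𝕜) (fun q : 𝕜 × M => c * q.1) p
      (((c • ContinuousLinearMap.id 𝕜 𝕜).comp (ContinuousLinearMap.fst 𝕜 𝕜 E) :) : 𝕜 × E →L[𝕜] 𝕜) := by
    have := (c • ContinuousLinearMap.id 𝕜 𝕜).hasMFDerivAt (x := p.1)
    exact HasMFDerivAt.comp p this (hasMFDerivAt_fst p)
  have h2 : HasMFDerivAt (𝓘(𝕜, 𝕜).prod I) 𝓘(𝕜, 𝕜) (fun q : 𝕜 × M => φ q.1) p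
      ((((1 : 𝕜 →L[𝕜] 𝕜).smulRight φ').comp (ContinuousLinearMap.fst 𝕜 𝕜 E) :) : 𝕜 × E →L[𝕜] 𝕜) :=
    HasMFDerivAt.comp p hφ.hasFDerivAt.hasMFDerivAt (hasMFDerivAt_fst p)
  have h3 : HasMFDerivAt (𝓘(𝕜, 𝕜).prod I) 𝓘(𝕜, 𝕜) (fun q : 𝕜 × M => a q.2) p
      ((ContinuousLinearMap.comp (show E →L[𝕜] 𝕜 from diff I a p.2)
        (ContinuousLinearMap.snd 𝕜 𝕜 E) :) : 𝕜 × E →L[𝕜] 𝕜) :=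
    HasMFDerivAt.comp p ha.hasMFDerivAt (hasMFDerivAt_snd p)
  have h4 := (h1.add (h2.mul h3)).mfderiv
  refine h4.trans ?_
  ext v
  rw [prodCovector_apply]
  change c * v.1 + (φ p.1 * (diff I a p.2 v.2) + a p.2 * (v.1 * φ')) =
    (c + a p.2 * φ') * v.1 + φ p.1 * diff I a p.2 v.2
  ring

/-- Differential of `c t + a(x)`. -/
theorem diff_affine {a : M → 𝕜} {p : 𝕜 × M} (ha : MDifferentiableAt I 𝓘(𝕜, 𝕜) a p.2) (c : 𝕜) :
    diff (𝓘(𝕜, 𝕜).prod I) (fun q : 𝕜 × M => c * q.1 + a q.2) p =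
      prodCovector I p c (diff I a p.2) := by
  have h := diff_fst_snd (I := I) (hasDerivAt_const p.1 (1 : 𝕜)) ha c
  simpa using h

/-- Differential of `e⁻ᵗ u(x)`. -/
theorem diff_exp_mul {u : M → 𝕜} {p : 𝕜 × M} (hu : MDifferentiableAt I 𝓘(𝕜, 𝕜) u p.2) :
    diff (𝓘(𝕜, 𝕜).prod I) (fun q : 𝕜 × M => (NormedSpace.exp q.1)⁻¹ * u q.2) p =
      prodCovector I p (-((NormedSpace.exp p.1)⁻¹ * u p.2))
        ((NormedSpace.exp p.1)⁻¹ • diff I u p.2) := by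
  have h := diff_fst_snd (I := I) (hasDerivAt_exp_inv p.1) hu 0
  simp only [zero_mul, zero_add, mul_neg] at h
  rw [h, mul_comm]

/-- The bracket `π(a, b) + c E[b] - d E[a]`. -/
def affineBracket (π : TwoTensorField I M) (X : VectorField I M) (c d : 𝕜) (a b : M → 𝕜) : M → 𝕜 :=
  fun x => π.onFun a b x + c * X.onFun b x - d * X.onFun a x

variable {π : TwoTensorField I M} {X : VectorField I M} {r : WithTop ℕ∞} {p : 𝕜 × M} {a b e : M → 𝕜}
  {c d k : 𝕜}

theorem poissonification_onFun_affine (ha : MDifferentiableAt I 𝓘(𝕜, 𝕜) a p.2)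
    (hb : MDifferentiableAt I 𝓘(𝕜, 𝕜) b p.2) :
    (poissonification π X).onFun (fun q : 𝕜 × M => c * q.1 + a q.2) (fun q => d * q.1 + b q.2) p =
      (NormedSpace.exp p.1)⁻¹ * affineBracket π X c d a b p.2 := by
  simp only [TwoTensorField.onFun, diff_affine ha, diff_affine hb, poissonification_prodCovector,
    affineBracket, VectorField.onFun]

theorem eventually_poissonification_onFun_affine [IsManifold I 1 M] (hr : 1 ≤ r)
    (ha : ContMDiffAt I 𝓘(𝕜, 𝕜) r a p.2) (hb : ContMDiffAt I 𝓘(𝕜, 𝕜) r b p.2) :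
    (poissonification π X).onFun (fun q : 𝕜 × M => c * q.1 + a q.2) (fun q => d * q.1 + b q.2)
      =ᶠ[𝓝 p] fun q => (NormedSpace.exp q.1)⁻¹ * affineBracket π X c d a b q.2 := by
  have h1 := ContMDiffAt.eventually_mdifferentiableAt hr ha
  have h2 := ContMDiffAt.eventually_mdifferentiableAt hr hb
  filter_upwards [continuousAt_snd.eventually h1, continuousAt_snd.eventually h2] with q hq1 hq2
  exact poissonification_onFun_affine hq1 hq2

theorem poissonification_onFun_exp {u : M → 𝕜} (hu : MDifferentiableAt I 𝓘(𝕜, 𝕜) u p.2)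
    (hb : MDifferentiableAt I 𝓘(𝕜, 𝕜) b p.2) :
    (poissonification π X).onFun (fun q : 𝕜 × M => (NormedSpace.exp q.1)⁻¹ * u q.2)
      (fun q => d * q.1 + b q.2) p =
      (NormedSpace.exp p.1)⁻¹ * (NormedSpace.exp p.1)⁻¹ *
        (π.onFun u b p.2 - u p.2 * X.onFun b p.2 - d * X.onFun u p.2) := by
  simp only [TwoTensorField.onFun, diff_affine hb, diff_exp_mul hu, poissonification_prodCovector,
    VectorField.onFun, map_smul, LinearMap.smul_apply, smul_eq_mul]
  rw [smul_apply, smul_eq_mul]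
  ring

theorem contMDiffAt_affineBracket (hJ : IsJacobi r π X) {x : M} (ha : ContMDiffAt I 𝓘(𝕜, 𝕜) r a x)
    (hb : ContMDiffAt I 𝓘(𝕜, 𝕜) r b x) :
    ContMDiffAt I 𝓘(𝕜, 𝕜) r (affineBracket π X c d a b) x := by
  have h1 := hJ.smooth x a b ha hb
  have h2 := hJ.smooth_vectorField x b hb
  have h3 := hJ.smooth_vectorField x a ha
  exact (h1.add (contMDiffAt_const.mul h2)).sub (contMDiffAt_const.mul h3)

theorem diff_affineBracket (hr : 1 ≤ r) (hJ : IsJacobi r π X) {x : M}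
    (ha : ContMDiffAt I 𝓘(𝕜, 𝕜) r a x) (hb : ContMDiffAt I 𝓘(𝕜, 𝕜) r b x) :
    diff I (affineBracket π X c d a b) x =
      diff I (π.onFun a b) x + c • diff I (X.onFun b) x - d • diff I (X.onFun a) x := by
  have hr0 : r ≠ 0 := by rintro rfl; simp at hr
  have h1 := (hJ.smooth x a b ha hb).mdifferentiableAt hr0
  have h2 := (hJ.smooth_vectorField x b hb).mdifferentiableAt hr0
  have h3 := (hJ.smooth_vectorField x a ha).mdifferentiableAt hr0
  exact ((h1.hasMFDerivAt.add (h2.hasMFDerivAt.const_smul c)).sub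
    (h3.hasMFDerivAt.const_smul d)).mfderiv

/-- A bracket of affine functions is `e⁻ᵗ u(x)`, whose `dt`-component is `-e⁻ᵗ u`; this is the
source of the term `-u E[·]`. In the cyclic sum the terms quadratic in the slopes `c, d, k` cancel,
the terms linear in a slope are multiples of `[E, π]`, and the rest is `[π, π] - 2 E ∧ π` up to a
factor. -/
theorem schoutenSelf_poissonification_affine [IsManifold I 1 M] (hr : 1 ≤ r)
    (hJ : IsJacobi r π X) (ha : ContMDiffAt I 𝓘(𝕜, 𝕜) r a p.2)
    (hb : ContMDiffAt I 𝓘(𝕜, 𝕜) r b p.2) (he : ContMDiffAt I 𝓘(𝕜, 𝕜) r e p.2) :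
    schoutenSelf (poissonification π X) (fun q : 𝕜 × M => c * q.1 + a q.2)
      (fun q => d * q.1 + b q.2) (fun q => k * q.1 + e q.2) p = 0 := by
  have hr0 : r ≠ 0 := by rintro rfl; simp at hr
  have step : ∀ {a b e : M → 𝕜} {c d k : 𝕜}, ContMDiffAt I 𝓘(𝕜, 𝕜) r a p.2 →
      ContMDiffAt I 𝓘(𝕜, 𝕜) r b p.2 → ContMDiffAt I 𝓘(𝕜, 𝕜) r e p.2 →
      (poissonification π X).onFun ((poissonification π X).onFun
        (fun q : 𝕜 × M => c * q.1 + a q.2) (fun q => d * q.1 + b q.2))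
        (fun q => k * q.1 + e q.2) p = (NormedSpace.exp p.1)⁻¹ * (NormedSpace.exp p.1)⁻¹ *
          (π.onFun (π.onFun a b) e p.2 + c * π.onFun (X.onFun b) e p.2
            - d * π.onFun (X.onFun a) e p.2
            - (π.onFun a b p.2 + c * X.onFun b p.2 - d * X.onFun a p.2) * X.onFun e p.2
            - k * (X.onFun (π.onFun a b) p.2 + c * X.onFun (X.onFun b) p.2
              - d * X.onFun (X.onFun a) p.2)) := by
    intro a b e c d k ha hb he
    have h1 : (poissonification π X).onFun ((poissonification π X).onFun
        (fun q : 𝕜 × M => c * q.1 + a q.2) (fun q => d * q.1 + b q.2))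
        (fun q => k * q.1 + e q.2) p = (poissonification π X).onFun
          (fun q => (NormedSpace.exp q.1)⁻¹ * affineBracket π X c d a b q.2)
          (fun q => k * q.1 + e q.2) p :=
      TwoTensorField.onFun_congr _ (eventually_poissonification_onFun_affine hr ha hb)
        EventuallyEq.rfl
    rw [h1, poissonification_onFun_exp
      ((contMDiffAt_affineBracket hJ ha hb).mdifferentiableAt hr0) (he.mdifferentiableAt hr0)]
    congr 1
    have hd := diff_affineBracket (c := c) (d := d) hr hJ ha hb
    have e1 : π.onFun (affineBracket π X c d a b) e p.2 = π.onFun (π.onFun a b) e p.2 +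
        c * π.onFun (X.onFun b) e p.2 - d * π.onFun (X.onFun a) e p.2 := by
      conv_lhs => unfold TwoTensorField.onFun
      rw [hd]
      simp only [map_add, map_sub, map_smul, LinearMap.add_apply, LinearMap.sub_apply,
        LinearMap.smul_apply, smul_eq_mul]
      rfl
    have e2 : X.onFun (affineBracket π X c d a b) p.2 = X.onFun (π.onFun a b) p.2 +
        c * X.onFun (X.onFun b) p.2 - d * X.onFun (X.onFun a) p.2 := by
      conv_lhs => unfold VectorField.onFun
      rw [hd]
      rfl
    rw [e1, e2]
    simp only [affineBracket]
  have hS := hJ.schouten p.2 a b e ha hb he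
  have l1 := hJ.lie p.2 a b ha hb
  have l2 := hJ.lie p.2 b e hb he
  have l3 := hJ.lie p.2 e a he ha
  simp only [schoutenSelf, wedge] at hS
  simp only [lieDerivative] at l1 l2 l3
  have sw : ∀ f g : M → 𝕜, π.onFun f g p.2 = - π.onFun g f p.2 := fun f g =>
    ((hJ.alt p.2).neg_eq _ _).symm
  rw [sw a (X.onFun b)] at l1
  rw [sw b (X.onFun e)] at l2
  rw [sw e (X.onFun a)] at l3
  have hS' := mul_left_cancel₀ (two_ne_zero (α := 𝕜)) (hS.trans (by ring :
    _ = 2 * (X.onFun a p.2 * π.onFun b e p.2 + X.onFun b p.2 * π.onFun e a p.2 +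
      X.onFun e p.2 * π.onFun a b p.2)))
  simp only [schoutenSelf]
  rw [step ha hb he, step hb he ha, step he ha hb]
  -- Each slope multiplies the Lie derivative identity for the other two functions.
  linear_combination 2 * (NormedSpace.exp p.1)⁻¹ * (NormedSpace.exp p.1)⁻¹ *
    (hS' - k * l1 - c * l2 - d * l3)

theorem vectorField_onFun_affine (ha : MDifferentiableAt I 𝓘(𝕜, 𝕜) a p.2) :
    (poissonificationField I M).onFun (fun q : 𝕜 × M => c * q.1 + a q.2) p = c := by
  simp only [VectorField.onFun, diff_affine ha, prodCovector_field]

theorem eventually_vectorField_onFun_affine [IsManifold I 1 M] (hr : 1 ≤ r)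
    (ha : ContMDiffAt I 𝓘(𝕜, 𝕜) r a p.2) :
    (poissonificationField I M).onFun (fun q : 𝕜 × M => c * q.1 + a q.2) =ᶠ[𝓝 p] fun _ => c := by
  filter_upwards [continuousAt_snd.eventually (ContMDiffAt.eventually_mdifferentiableAt hr ha)]
    with q hq
  exact vectorField_onFun_affine hq

/-- `∂/∂t` sends affine functions to constants, so only the derivative of the factor `e⁻ᵗ`
contributes, and it gives the sign. -/
theorem lieDerivative_poissonification_affine [IsManifold I 1 M] (hr : 1 ≤ r)
    (hJ : IsJacobi r π X) (ha : ContMDiffAt I 𝓘(𝕜, 𝕜) r a p.2)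
    (hb : ContMDiffAt I 𝓘(𝕜, 𝕜) r b p.2) :
    lieDerivative (poissonificationField I M) (poissonification π X)
      (fun q : 𝕜 × M => c * q.1 + a q.2) (fun q => d * q.1 + b q.2) p =
    - (poissonification π X).onFun (fun q : 𝕜 × M => c * q.1 + a q.2)
      (fun q => d * q.1 + b q.2) p := by
  have hr0 : r ≠ 0 := by rintro rfl; simp at hr
  have h1 := VectorField.onFun_congr (poissonificationField I M)
    (eventually_poissonification_onFun_affine (π := π) (X := X) (c := c) (d := d) hr ha hb)
  have h2 : (poissonification π X).onFun
      ((poissonificationField I M).onFun (fun q : 𝕜 × M => c * q.1 + a q.2))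
      (fun q => d * q.1 + b q.2) p = 0 := by
    rw [TwoTensorField.onFun_congr _ (eventually_vectorField_onFun_affine hr ha) EventuallyEq.rfl]
    simp only [TwoTensorField.onFun, diff_const, map_zero, LinearMap.zero_apply]
  have h3 : (poissonification π X).onFun (fun q : 𝕜 × M => c * q.1 + a q.2)
      ((poissonificationField I M).onFun (fun q => d * q.1 + b q.2)) p = 0 := by
    rw [TwoTensorField.onFun_congr _ EventuallyEq.rfl (eventually_vectorField_onFun_affine hr hb)]
    simp only [TwoTensorField.onFun, diff_const, map_zero]
  simp only [lieDerivative]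
  rw [h2, h3, h1, VectorField.onFun,
    diff_exp_mul ((contMDiffAt_affineBracket hJ ha hb).mdifferentiableAt hr0), prodCovector_field,
    poissonification_onFun_affine (ha.mdifferentiableAt hr0) (hb.mdifferentiableAt hr0)]
  ring

/-- The chart of `𝕜 × M` at `p` is `(t, x) ↦ (t, ψ x)`. Its coordinates in any basis of `𝕜 × E` are
affine in `t`, with constant slopes the coordinates of `(1, 0)`. -/
theorem exists_affine_coordinateSystem [FiniteDimensional 𝕜 E] [I.Boundaryless]
    (hr : r = ∞ ∨ r = ω) [IsManifold I r M] (p : 𝕜 × M) :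
    ∃ (n : ℕ) (c : Fin n → 𝕜) (a : Fin n → M → 𝕜),
      (∀ i, ContMDiffAt I 𝓘(𝕜, 𝕜) r (a i) p.2) ∧
      IsCoordinateSystemAt (𝓘(𝕜, 𝕜).prod I) r
        (fun i (q : 𝕜 × M) => c i * q.1 + a i q.2) p := by
  let B := Module.finBasis 𝕜 (𝕜 × E)
  refine ⟨_, fun i => B.repr ((1 : 𝕜), (0 : E)) i,
    fun i x => B.repr ((0 : 𝕜), extChartAt I p.2 x) i, fun i => ?_, ?_⟩
  · let l : E →L[𝕜] 𝕜 := (LinearMap.toContinuousLinearMap (B.coord i)).comp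
      (ContinuousLinearMap.inr 𝕜 𝕜 E)
    exact l.contMDiff.contMDiffAt.comp p.2 (contMDiffAt_extChartAt (I := I) (n := r))
  · have h := isCoordinateSystemAt_extChartAt (I := 𝓘(𝕜, 𝕜).prod I) hr B p
    have e : (fun i (q : 𝕜 × M) => B.repr ((1 : 𝕜), (0 : E)) i * q.1 +
        B.repr ((0 : 𝕜), extChartAt I p.2 q.2) i) =
        fun i (q : 𝕜 × M) => B.repr (extChartAt (𝓘(𝕜, 𝕜).prod I) p q) i := by
      funext i q
      have : extChartAt (𝓘(𝕜, 𝕜).prod I) p q =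
          q.1 • ((1 : 𝕜), (0 : E)) + ((0 : 𝕜), extChartAt I p.2 q.2) := by
        rw [extChartAt_prod]
        simp only [PartialEquiv.prod_coe, Prod.smul_mk, Prod.mk_add_mk, smul_eq_mul, mul_one,
          smul_zero, add_zero, zero_add]
        rfl
      rw [this, map_add, map_smul, Finsupp.add_apply, Finsupp.smul_apply, smul_eq_mul, mul_comm]
    rw [e]
    exact h

theorem poissonificationField_isComplete :
    (poissonificationField I M : VectorField (𝓘(𝕜, 𝕜).prod I) (𝕜 × M)).IsComplete := by
  intro p
  refine ⟨fun t => (p.1 + t, p.2), by simp, fun t => ?_⟩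
  have h1 : HasMFDerivAt 𝓘(𝕜, 𝕜) 𝓘(𝕜, 𝕜) (fun t : 𝕜 => p.1 + t) t (ContinuousLinearMap.id 𝕜 𝕜) :=
    ((hasFDerivAt_id t).const_add p.1).hasMFDerivAt
  have h2 := h1.prodMk (hasMFDerivAt_const (I := 𝓘(𝕜, 𝕜)) (I' := I) p.2 t)
  have e : ((1 : 𝕜 →L[𝕜] 𝕜).smulRight ((1 : 𝕜), (0 : E)) : 𝕜 →L[𝕜] 𝕜 × E) =
      (ContinuousLinearMap.id 𝕜 𝕜).prod 0 := by
    ext <;> simp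
  exact h2.congr_mfderiv e.symm

/-- The Poissonification of a Jacobi manifold is a homogeneous Poisson manifold. -/
theorem IsJacobi.isHomogeneousPoisson [FiniteDimensional 𝕜 E] [I.Boundaryless]
    (hr : r = ∞ ∨ r = ω) [IsManifold I r M] (hJ : IsJacobi r π X) :
    IsHomogeneousPoisson r (poissonification π X) (poissonificationField I M) := by
  have h1 := one_le_of_eq hr
  have hr0 : r ≠ 0 := by rintro rfl; simp at h1
  have : IsManifold I 1 M := .of_le h1
  have halt : ∀ p, (poissonification π X p).IsAlt := by
    intro p α
    rw [eq_prodCovector p α, poissonification_prodCovector, (hJ.alt p.2).self_eq_zero]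
    ring
  have hs : (poissonification π X).IsSmooth r := by
    intro p f g hf hg
    obtain ⟨n, c, a, ha, hy⟩ := exists_affine_coordinateSystem (I := I) hr p
    refine hy.contMDiffAt_onFun (fun i j => ?_) hf hg
    refine ContMDiffAt.congr_of_eventuallyEq ?_
      (eventually_poissonification_onFun_affine h1 (ha i) (ha j))
    have e1 : ContMDiffAt (𝓘(𝕜, 𝕜).prod I) 𝓘(𝕜, 𝕜) r
        (fun q : 𝕜 × M => (NormedSpace.exp q.1)⁻¹) p :=
      contDiff_exp_inv.contMDiff.contMDiffAt.comp p contMDiffAt_fst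
    have e2 : ContMDiffAt (𝓘(𝕜, 𝕜).prod I) 𝓘(𝕜, 𝕜) r
        (fun q : 𝕜 × M => affineBracket π X (c i) (c j) (a i) (a j) q.2) p :=
      (contMDiffAt_affineBracket hJ (ha i) (ha j)).comp p contMDiffAt_snd
    exact e1.mul e2
  have hZ : (poissonificationField I M : VectorField (𝓘(𝕜, 𝕜).prod I) (𝕜 × M)).IsSmooth r := by
    intro p f hf
    obtain ⟨n, c, a, ha, hy⟩ := exists_affine_coordinateSystem (I := I) hr p
    refine hy.contMDiffAt_vectorField (fun i => ?_) hf
    exact contMDiffAt_const.congr_of_eventuallyEq (eventually_vectorField_onFun_affine h1 (ha i))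
  refine ⟨⟨halt, hs, fun p f g h hf hg hh => ?_⟩, hZ, poissonificationField_isComplete,
    fun p f g hf hg => ?_⟩
  · obtain ⟨n, c, a, ha, hy⟩ := exists_affine_coordinateSystem (I := I) hr p
    exact hy.schoutenSelf_eq_zero h1 halt (hs p) hf hg hh fun i j k =>
      schoutenSelf_poissonification_affine h1 hJ (ha i) (ha j) (ha k)
  · obtain ⟨n, c, a, ha, hy⟩ := exists_affine_coordinateSystem (I := I) hr p
    exact hy.lieDerivative_eq_neg h1 halt (hs p) (hZ p) hf hg fun i j =>
      lieDerivative_poissonification_affine h1 hJ (ha i) (ha j)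

end Poissonification

/-! ### Linear algebra of `ξ ∧ Bⁿ` in dimension `2n+1` -/

section LinearAlgebra

variable {𝕜 : Type*} [Field 𝕜] {W : Type*} [AddCommGroup W] [Module 𝕜 W]

/-- The multilinear form `(a_k) ↦ ξ(a_∅) ∏ B(a_(i,0), a_(i,1))`. -/
def pairingForm (n : ℕ) (ξ : W →ₗ[𝕜] 𝕜) (B : LinearMap.BilinForm 𝕜 W) :
    MultilinearMap 𝕜 (fun _ : Option (Fin n × Bool) => W) 𝕜 where
  toFun a := ξ (a none) * ∏ i, B (a (some (i, false))) (a (some (i, true)))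
  map_update_add' := by
    intro _ m k x y
    rcases k with _ | ⟨j, b⟩
    · simp [add_mul]
    · simp only [Fintype.prod_eq_mul_prod_compl j]
      have h : ∀ z : W, ∏ i ∈ {j}ᶜ, B (Function.update m (some (j, b)) z (some (i, false)))
          (Function.update m (some (j, b)) z (some (i, true))) =
          ∏ i ∈ {j}ᶜ, B (m (some (i, false))) (m (some (i, true))) := fun z =>
        Finset.prod_congr rfl fun i hi => by
          have : i ≠ j := by simpa using hi
          simp [this]
      simp only [h]
      cases b <;> simp <;> ring
  map_update_smul' := by
    intro _ m k c x
    rcases k with _ | ⟨j, b⟩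
    · simp [mul_assoc]
    · simp only [Fintype.prod_eq_mul_prod_compl j]
      have h : ∀ z : W, ∏ i ∈ {j}ᶜ, B (Function.update m (some (j, b)) z (some (i, false)))
          (Function.update m (some (j, b)) z (some (i, true))) =
          ∏ i ∈ {j}ᶜ, B (m (some (i, false))) (m (some (i, true))) := fun z =>
        Finset.prod_congr rfl fun i hi => by
          have : i ≠ j := by simpa using hi
          simp [this]
      simp only [h]
      cases b <;> simp <;> ring

theorem pairingForm_apply {n : ℕ} (ξ : W →ₗ[𝕜] 𝕜) (B : LinearMap.BilinForm 𝕜 W)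
    (a : Option (Fin n × Bool) → W) : pairingForm n ξ B a =
      ξ (a none) * ∏ i, B (a (some (i, false))) (a (some (i, true))) := rfl

theorem pairingForm_alternatization {n : ℕ} (ξ : W →ₗ[𝕜] 𝕜) (B : LinearMap.BilinForm 𝕜 W)
    (a : Option (Fin n × Bool) → W) : MultilinearMap.alternatization (pairingForm n ξ B) a =
      ∑ s : Equiv.Perm (Option (Fin n × Bool)), ((Equiv.Perm.sign s : ℤ) : 𝕜) *
        pairingForm n ξ B fun k => a (s k) := by
  rw [MultilinearMap.alternatization_apply]
  refine Finset.sum_congr rfl fun s _ => ?_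
  rw [Units.smul_def, zsmul_eq_mul]
  rfl

/-- Exchanging the argument of `ξ` with the partner of `α` does not change the value, when
`B α = c ξ`. -/
theorem pairingForm_swap {n : ℕ} {ξ : W →ₗ[𝕜] 𝕜} {B : LinearMap.BilinForm 𝕜 W} (hB : B.IsAlt)
    {α : W} {c : 𝕜} (hα : ∀ β, B α β = c * ξ β) (a : Option (Fin n × Bool) → W) (j : Fin n)
    (b : Bool) (ha : a (some (j, b)) = α) :
    pairingForm n ξ B (fun k => a (Equiv.swap none (some (j, !b)) k)) = pairingForm n ξ B a := by
  have hα' : ∀ β, B β α = - (c * ξ β) := fun β => by rw [← hα, hB.neg_eq]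
  simp only [pairingForm_apply, Fintype.prod_eq_mul_prod_compl j]
  have h : ∏ i ∈ {j}ᶜ, B (a (Equiv.swap none (some (j, !b)) (some (i, false))))
      (a (Equiv.swap none (some (j, !b)) (some (i, true)))) =
      ∏ i ∈ {j}ᶜ, B (a (some (i, false))) (a (some (i, true))) :=
    Finset.prod_congr rfl fun i hi => by
      have : i ≠ j := by simpa using hi
      rw [Equiv.swap_apply_of_ne_of_ne, Equiv.swap_apply_of_ne_of_ne] <;> simp [this]
  rw [h]
  have hs : Equiv.swap none (some (j, !b)) (some (j, b)) = some (j, b) :=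
    Equiv.swap_apply_of_ne_of_ne (by simp) (by simp)
  cases b
  · simp only [Bool.not_false] at hs ⊢
    rw [Equiv.swap_apply_left, hs, Equiv.swap_apply_right, ha, hα, hα]
    ring
  · simp only [Bool.not_true] at hs ⊢
    rw [Equiv.swap_apply_left, hs, Equiv.swap_apply_right, ha, hα', hα']
    ring

/-- This is `i_α (ξ ∧ Bⁿ) = 0`: contracting `ξ` gives `ξ α = 0`, and contracting a factor `B` gives
`c ξ ∧ ξ = 0`. On the signed sum, the second cancellation is a sign-reversing involution of the
permutations. -/
theorem alternatization_eq_zero_of_mem [CharZero 𝕜] {n : ℕ} {ξ : W →ₗ[𝕜] 𝕜}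
    {B : LinearMap.BilinForm 𝕜 W}
    (hB : B.IsAlt) {α : W} {c : 𝕜} (hξ : ξ α = 0) (hα : ∀ β, B α β = c * ξ β)
    (a : Option (Fin n × Bool) → W) (k : Option (Fin n × Bool)) (hk : a k = α) :
    MultilinearMap.alternatization (pairingForm n ξ B) a = 0 := by
  rw [pairingForm_alternatization]
  -- If `α` sits in a pair, exchange its partner with the argument of `ξ`. If `α` is itself the
  -- argument of `ξ`, the term is zero and the permutation is left alone.
  let g : Equiv.Perm (Option (Fin n × Bool)) → Equiv.Perm (Option (Fin n × Bool)) := fun s =>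
    (s⁻¹ k).elim s fun q => s * Equiv.swap none (some (q.1, !q.2))
  have g_none : ∀ s, s⁻¹ k = none → g s = s := fun s h => by simp only [g, h, Option.elim]
  have g_some : ∀ s j b, s⁻¹ k = some (j, b) → g s = s * Equiv.swap none (some (j, !b)) :=
    fun s j b h => by simp only [g, h, Option.elim]
  have zero_of_none : ∀ s : Equiv.Perm (Option (Fin n × Bool)), s⁻¹ k = none →
      ((Equiv.Perm.sign s : ℤ) : 𝕜) * pairingForm n ξ B (fun k => a (s k)) = 0 := by
    intro s h
    have : s none = k := by rw [← h]; simp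
    rw [pairingForm_apply, this, hk, hξ, zero_mul, mul_zero]
  have add_eq : ∀ s, ((Equiv.Perm.sign s : ℤ) : 𝕜) * pairingForm n ξ B (fun k => a (s k)) +
      ((Equiv.Perm.sign (g s) : ℤ) : 𝕜) * pairingForm n ξ B (fun k => a (g s k)) = 0 := by
    intro s
    rcases h : s⁻¹ k with _ | ⟨j, b⟩
    · rw [g_none s h, zero_of_none s h, add_zero]
    · rw [g_some s j b h]
      have hsk : s (some (j, b)) = k := by rw [← h]; simp
      have := pairingForm_swap hB hα (fun k => a (s k)) j b (by rw [hsk, hk])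
      simp only [Equiv.Perm.mul_apply]
      rw [this, Equiv.Perm.sign_mul, Equiv.Perm.sign_swap (by simp)]
      push_cast
      ring
  refine Finset.sum_involution (fun s _ => g s) (fun s _ => add_eq s) (fun s _ hs he => hs ?_)
    (fun _ _ => Finset.mem_univ _) fun s _ => ?_
  · have := add_eq s
    rw [he, ← two_mul] at this
    exact (mul_eq_zero.1 this).resolve_left two_ne_zero
  · rcases h : s⁻¹ k with _ | ⟨j, b⟩
    · rw [g_none s h, g_none s h]
    -- The exchange does not move `α`, so applying it twice uses the same transposition.
    · have h' : (g s)⁻¹ k = some (j, b) := by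
        rw [g_some s j b h, mul_inv_rev, Equiv.Perm.mul_apply, h, Equiv.swap_inv]
        exact Equiv.swap_apply_of_ne_of_ne (by simp) (by simp)
      rw [g_some _ j b h', g_some s j b h, mul_assoc, Equiv.swap_mul_self, mul_one]

/-- If `ξ ∧ Bⁿ ≠ 0` in dimension `2n+1`, the form `B + dt ∧ ξ` on `𝕜 × W` is nondegenerate. -/
theorem eq_zero_of_alternatization_ne_zero [CharZero 𝕜] {n : ℕ}
    (hW : Module.finrank 𝕜 W = 2 * n + 1)
    {ξ : W →ₗ[𝕜] 𝕜} {B : LinearMap.BilinForm 𝕜 W} (hB : B.IsAlt) {a : Option (Fin n × Bool) → W}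
    (ha : MultilinearMap.alternatization (pairingForm n ξ B) a ≠ 0) {α : W} {c : 𝕜}
    (hξ : ξ α = 0) (hα : ∀ β, B α β = c * ξ β) : c = 0 ∧ α = 0 := by
  have hα0 : α = 0 := by
    by_contra hne
    have hli : LinearIndependent 𝕜 a := by
      by_contra hli
      exact ha (AlternatingMap.map_linearDependent _ a hli)
    let b := basisOfLinearIndependentOfCardEqFinrank hli (by simp [hW, mul_comm])
    have hb : ∀ k, b k = a k := fun k => by simp [b]
    obtain ⟨k, hk⟩ : ∃ k, b.repr α k ≠ 0 := by
      by_contra! h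
      exact hne (b.repr.map_eq_zero_iff.1 (Finsupp.ext h))
    -- Replacing `a k` by `α` multiplies the value by the `k`-th coordinate of `α`, which is
    -- nonzero, while a tuple containing `α` must give zero.
    have h1 := alternatization_eq_zero_of_mem hB hξ hα (Function.update a k α) k (by simp)
    have h2 : MultilinearMap.alternatization (pairingForm n ξ B) (Function.update a k α) =
        b.repr α k * MultilinearMap.alternatization (pairingForm n ξ B) a := by
      conv_lhs => rw [← b.sum_repr α]
      rw [AlternatingMap.map_update_sum, Finset.sum_eq_single k]
      · rw [AlternatingMap.map_update_smul, hb, Function.update_eq_self, smul_eq_mul]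
      · intro l _ hl
        rw [AlternatingMap.map_update_smul, hb, AlternatingMap.map_update_self _ _ hl.symm,
          smul_zero]
      · simp
    rw [h2] at h1
    exact (mul_ne_zero hk ha) h1
  refine ⟨?_, hα0⟩
  -- With `α = 0` and `c ≠ 0`, the relation `B α = c ξ` forces `ξ = 0`, hence the whole form to
  -- vanish.
  by_contra hc
  have hξ0 : ξ = 0 := by
    ext β
    have := hα β
    rw [hα0, map_zero, LinearMap.zero_apply] at this
    simpa [hc] using this.symm
  apply ha
  rw [pairingForm_alternatization]
  simp [pairingForm_apply, hξ0]

/-- A nondegenerate alternating form on a space of dimension at least `2k` has a symplectic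
family of `k` pairs. -/
theorem exists_symplectic_family [FiniteDimensional 𝕜 W] {B : LinearMap.BilinForm 𝕜 W}
    (hB : B.IsAlt) (hnd : ∀ α, (∀ β, B α β = 0) → α = 0) (k : ℕ)
    (hk : 2 * k ≤ Module.finrank 𝕜 W) : ∃ p q : Fin k → W, (∀ i j, B (p i) (p j) = 0) ∧
      (∀ i j, B (q i) (q j) = 0) ∧ ∀ i j, B (p i) (q j) = if i = j then 1 else 0 := by
  induction k with
  | zero => exact ⟨Fin.elim0, Fin.elim0, fun i => i.elim0, fun i => i.elim0, fun i => i.elim0⟩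
  | succ k ih =>
    obtain ⟨p, q, hpp, hqq, hpq⟩ := ih (by omega)
    have hqp : ∀ i j, B (q i) (p j) = if i = j then -1 else 0 := by
      intro i j
      rw [← hB.neg_eq, hpq]
      by_cases h : i = j <;> simp [h, eq_comm]
    -- The projection onto the `B`-orthogonal complement of the family found so far.
    let P : W → W := fun w => w - ∑ i, B w (q i) • p i + ∑ i, B w (p i) • q i
    have hPq : ∀ w j, B (P w) (q j) = 0 := by
      intro w j
      simp [P, hpq, hqq, map_sum, LinearMap.sum_apply]
    have hPp : ∀ w j, B (P w) (p j) = 0 := by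
      intro w j
      simp [P, hpp, hqp, map_sum, LinearMap.sum_apply]
    obtain ⟨w, hw⟩ : ∃ w, P w ≠ 0 := by
      by_contra! h
      -- If the projection were zero, the `2k` vectors already chosen would span, against the
      -- dimension bound.
      have hspan : Submodule.span 𝕜 (Set.range (Sum.elim p q)) = ⊤ := by
        rw [eq_top_iff]
        intro w _
        have hpm : ∀ i, p i ∈ Submodule.span 𝕜 (Set.range (Sum.elim p q)) := fun i =>
          Submodule.subset_span ⟨Sum.inl i, rfl⟩
        have hqm : ∀ i, q i ∈ Submodule.span 𝕜 (Set.range (Sum.elim p q)) := fun i =>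
          Submodule.subset_span ⟨Sum.inr i, rfl⟩
        have e : w = ∑ i, B w (q i) • p i - ∑ i, B w (p i) • q i := by
          have h' : w - ∑ i, B w (q i) • p i + ∑ i, B w (p i) • q i = 0 := h w
          rw [eq_sub_iff_add_eq, ← sub_eq_zero, ← h']
          abel
        rw [e]
        exact Submodule.sub_mem _ (Submodule.sum_mem _ fun i _ => Submodule.smul_mem _ _ (hpm i))
          (Submodule.sum_mem _ fun i _ => Submodule.smul_mem _ _ (hqm i))
      have := finrank_range_le_card (R := 𝕜) (Sum.elim p q)
      rw [Set.finrank, hspan, finrank_top] at this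
      simp at this
      omega
    obtain ⟨z, hz⟩ : ∃ z, B (P w) z ≠ 0 := by
      by_contra! h
      exact hw (hnd _ h)
    -- Projecting `z` does not change its pairing with `P w`, which is orthogonal to the family; the
    -- scalar makes that pairing 1.
    let v := P ((B (P w) z)⁻¹ • z)
    have hv : B (P w) v = 1 := by
      have : B (P w) v = B (P w) ((B (P w) z)⁻¹ • z) := by
        simp only [v]
        conv_lhs => rw [show P ((B (P w) z)⁻¹ • z) = (B (P w) z)⁻¹ • z -
          ∑ i, B ((B (P w) z)⁻¹ • z) (q i) • p i + ∑ i, B ((B (P w) z)⁻¹ • z) (p i) • q i from rfl]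
        rw [map_add, map_sub, map_sum, map_sum]
        simp [hPq, hPp]
      rw [this, map_smul, smul_eq_mul, inv_mul_cancel₀ hz]
    have hvw : ∀ x y, B x y = 0 → B y x = 0 := fun x y h => by rw [← hB.neg_eq, h, neg_zero]
    refine ⟨Fin.cons (P w) p, Fin.cons v q, ?_, ?_, ?_⟩
    · intro i j
      refine Fin.cases ?_ (fun i => ?_) i <;> refine Fin.cases ?_ (fun j => ?_) j
      · simpa using hB _
      · simpa using hPp _ _
      · simpa using hvw _ _ (hPp _ _)
      · simpa using hpp _ _
    · intro i j
      refine Fin.cases ?_ (fun i => ?_) i <;> refine Fin.cases ?_ (fun j => ?_) j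
      · simpa using hB _
      · simpa using hPq _ _
      · simpa using hvw _ _ (hPq _ _)
      · simpa using hqq _ _
    · intro i j
      refine Fin.cases ?_ (fun i => ?_) i <;> refine Fin.cases ?_ (fun j => ?_) j
      · simpa using hv
      · simpa [Fin.succ_ne_zero, eq_comm] using hPq _ _
      · simpa [Fin.succ_ne_zero] using hvw _ _ (hPp _ _)
      · simpa using hpq _ _

/-- The sign of a permutation of `Fin n × Bool` that respects the pairs `{(i, 0), (i, 1)}`. -/
theorem sign_eq_of_pairs {n : ℕ} (s : Equiv.Perm (Fin n × Bool)) (ρ : Fin n → Fin n)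
    (c : Fin n → Bool) (h0 : ∀ i, s (i, false) = (ρ i, c i)) (h1 : ∀ i, s (i, true) = (ρ i, !c i)) :
    Equiv.Perm.sign s = ∏ i, if c i then -1 else 1 := by
  have hρ : Function.Injective ρ := by
    intro i j hij
    by_cases hc : c i = c j
    · have := s.injective ((h0 i).trans ((by rw [hij, hc] : _ = (ρ j, c j)).trans (h0 j).symm))
      exact (Prod.mk.inj this).1
    · have hc' : c i = !c j := by cases h : c i <;> cases h' : c j <;> simp_all
      have := s.injective ((h0 i).trans ((by rw [hij, hc'] : _ = (ρ j, !c j)).trans (h1 j).symm))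
      exact (Prod.mk.inj this).1
  let ρ' : Equiv.Perm (Fin n) := Equiv.ofBijective ρ (Finite.injective_iff_bijective.1 hρ)
  let σ : Fin n → Equiv.Perm Bool := fun i => if c i then Equiv.swap false true else 1
  -- The permutation `ρ` of the pairs acts in the same way on both copies of `Fin n`, so its sign
  -- appears squared; only the flips inside the pairs count.
  have hs : s = Equiv.prodCongrLeft (fun _ : Bool => ρ') * Equiv.prodCongrRight σ := by
    ext1 ⟨i, b⟩
    rw [Equiv.Perm.mul_apply, Equiv.prodCongrRight_apply, Equiv.prodCongrLeft_apply]
    have : ρ' i = ρ i := rfl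
    rw [this]
    cases b
    · rw [h0]; cases h : c i <;> simp [σ, h]
    · rw [h1]; cases h : c i <;> simp [σ, h]
  rw [hs, Equiv.Perm.sign_mul, Equiv.Perm.sign_prodCongrLeft, Equiv.Perm.sign_prodCongrRight]
  simp only [Finset.prod_const, Finset.card_univ, Fintype.card_bool, Int.units_sq, one_mul]
  refine Finset.prod_congr rfl fun i _ => ?_
  by_cases h : c i <;> simp [σ, h]

/-- A permutation with a nonzero term fixes `none` and maps pairs to pairs. Its sign is `-1` to the
number of flipped pairs, and so is the product of the values of `B`. Every nonzero term is therefore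
1, and the sum is a positive count. -/
theorem alternatization_symplectic_ne_zero [CharZero 𝕜] {n : ℕ} {ξ : W →ₗ[𝕜] 𝕜}
    {B : LinearMap.BilinForm 𝕜 W} (hB : B.IsAlt) {p q : Fin n → W} {a₀ : W} (h₀ : ξ a₀ = 1)
    (hp : ∀ i, ξ (p i) = 0) (hq : ∀ i, ξ (q i) = 0) (hpp : ∀ i j, B (p i) (p j) = 0)
    (hqq : ∀ i j, B (q i) (q j) = 0) (hpq : ∀ i j, B (p i) (q j) = if i = j then 1 else 0) :
    MultilinearMap.alternatization (pairingForm n ξ B)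
      (fun k => k.elim a₀ fun l => bif l.2 then q l.1 else p l.1) ≠ 0 := by
  classical
  set a : Option (Fin n × Bool) → W := fun k => k.elim a₀ fun l => bif l.2 then q l.1 else p l.1
    with ha
  have hqp : ∀ i j, B (q i) (p j) = if i = j then -1 else 0 := by
    intro i j
    rw [← hB.neg_eq, hpq]
    by_cases h : i = j <;> simp [h, eq_comm]
  have ha_none : a none = a₀ := rfl
  have ha_false : ∀ i, a (some (i, false)) = p i := fun i => rfl
  have ha_true : ∀ i, a (some (i, true)) = q i := fun i => rfl
  have term : ∀ s : Equiv.Perm (Option (Fin n × Bool)),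
      ((Equiv.Perm.sign s : ℤ) : 𝕜) * pairingForm n ξ B (fun k => a (s k)) =
        if pairingForm n ξ B (fun k => a (s k)) ≠ 0 then 1 else 0 := by
    intro s
    by_cases hs : pairingForm n ξ B (fun k => a (s k)) = 0
    · simp [hs]
    rw [if_pos hs]
    rw [pairingForm_apply] at hs ⊢
    have hξ := left_ne_zero_of_mul hs
    have hfac := fun i => Finset.prod_ne_zero_iff.1 (right_ne_zero_of_mul hs) i (Finset.mem_univ i)
    have hnone : s none = none := by
      rcases h : s none with _ | ⟨j, b⟩
      · rfl
      · rw [h] at hξ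
        cases b
        · exact absurd (hp j) hξ
        · exact absurd (hq j) hξ
    have hsome : ∀ l, ∃ l', s (some l) = some l' := fun l =>
      Option.ne_none_iff_exists'.1 fun h => by
        have := s.injective (h.trans hnone.symm)
        simp at this
    let s' := Equiv.removeNone s
    have hs' : ∀ l, s (some l) = some (s' l) := fun l =>
      (Equiv.removeNone_some s (hsome l)).symm
    have hss : s = Equiv.optionCongr s' := by
      ext1 k
      rcases k with _ | l
      · rw [hnone]; rfl
      · rw [hs']; rfl
    have h1 : ∀ i, s' (i, true) = ((s' (i, false)).1, !(s' (i, false)).2) := by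
      intro i
      have := hfac i
      rw [hs', hs'] at this
      rcases e1 : s' (i, false) with ⟨j, b⟩
      rcases e2 : s' (i, true) with ⟨j', b'⟩
      rw [e1, e2] at this
      cases b <;> cases b' <;> simp only [ha_false, ha_true, hpp, hqq, hpq, hqp] at this
      · exact absurd rfl this
      · have : j = j' := by by_contra h; simp [h] at this
        simp [this]
      · have : j = j' := by by_contra h; simp [h] at this
        simp [this]
      · exact absurd rfl this
    have hsign := sign_eq_of_pairs s' (fun i => (s' (i, false)).1) (fun i => (s' (i, false)).2)
      (fun i => rfl) h1
    have hprod : ∏ i, B (a (s (some (i, false)))) (a (s (some (i, true)))) =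
        ∏ i, if (s' (i, false)).2 then (-1 : 𝕜) else 1 := by
      refine Finset.prod_congr rfl fun i _ => ?_
      rw [hs', hs', h1]
      rcases s' (i, false) with ⟨j, b⟩
      cases b
      · simp [ha_false, ha_true, hpq]
      · simp [ha_false, ha_true, hqp]
    rw [hprod, hnone, ha_none, h₀, one_mul, hss, Equiv.optionCongr_sign, hsign]
    push_cast
    rw [← Finset.prod_mul_distrib]
    refine Finset.prod_eq_one fun i _ => ?_
    by_cases h : (s' (i, false)).2 = true <;> simp [h]
  rw [pairingForm_alternatization, Finset.sum_congr rfl fun s _ => term s, Finset.sum_boole]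
  rw [Nat.cast_ne_zero, Finset.card_ne_zero]
  -- The identity permutation contributes, so the count is not zero.
  refine ⟨1, Finset.mem_filter.2 ⟨Finset.mem_univ _, ?_⟩⟩
  simp [pairingForm_apply, ha_none, ha_false, ha_true, h₀, hpq]

/-- If the form `B + dt ∧ ξ` on `𝕜 × W` is nondegenerate, then `ξ ∧ Bⁿ ≠ 0`. -/
theorem exists_alternatization_ne_zero [CharZero 𝕜] [FiniteDimensional 𝕜 W] {n : ℕ}
    (hW : Module.finrank 𝕜 W = 2 * n + 1)
    {ξ : W →ₗ[𝕜] 𝕜} {B : LinearMap.BilinForm 𝕜 W} (hB : B.IsAlt)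
    (h : ∀ (α : W) (c : 𝕜), ξ α = 0 → (∀ β, B α β = c * ξ β) → c = 0 ∧ α = 0) :
    ∃ a, MultilinearMap.alternatization (pairingForm n ξ B) a ≠ 0 := by
  have hξ : ξ ≠ 0 := by
    intro h0
    have := (h 0 1 (map_zero _) fun β => by simp [h0]).1
    exact one_ne_zero this
  obtain ⟨a₁, ha₁⟩ : ∃ a, ξ a ≠ 0 := by
    by_contra! h0
    exact hξ (LinearMap.ext h0)
  obtain ⟨a₀, h₀⟩ : ∃ a, ξ a = 1 := ⟨(ξ a₁)⁻¹ • a₁, by simp [ha₁]⟩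
  have hrange : LinearMap.range ξ = ⊤ :=
    LinearMap.range_eq_top.2 fun c => ⟨c • a₀, by simp [h₀]⟩
  have hfin : Module.finrank 𝕜 (LinearMap.ker ξ) = 2 * n := by
    have := LinearMap.finrank_range_add_finrank_ker ξ
    rw [hrange, finrank_top, Module.finrank_self, hW] at this
    omega
  let B' : LinearMap.BilinForm 𝕜 (LinearMap.ker ξ) := B.restrict (LinearMap.ker ξ)
  have hB' : B'.IsAlt := fun x => hB x
  have hnd : ∀ α, (∀ β, B' α β = 0) → α = 0 := by
    intro α hα
    have := (h α (B α a₀) α.2 fun β => ?_).2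
    · exact Subtype.ext this
    · have hβ : β - ξ β • a₀ ∈ LinearMap.ker ξ := by simp [h₀]
      have h1 : B α (β - ξ β • a₀) = 0 := hα ⟨_, hβ⟩
      rw [map_sub, map_smul, sub_eq_zero, smul_eq_mul] at h1
      rw [h1, mul_comm]
  obtain ⟨p, q, hpp, hqq, hpq⟩ := exists_symplectic_family hB' hnd n hfin.ge
  exact ⟨_, alternatization_symplectic_ne_zero (p := fun i => (p i : W)) (q := fun i => (q i : W))
    hB h₀ (fun i => (p i).2) (fun i => (q i).2) hpp hqq hpq⟩

/-- `none ↦ 0`, `(i, 0) ↦ 2i+1`, `(i, 1) ↦ 2i+2`. -/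
def pairIndexEquiv (n : ℕ) : Option (Fin n × Bool) ≃ Fin (2 * n + 1) :=
  Equiv.ofBijective (fun k => k.elim ⟨0, by omega⟩ fun l =>
      bif l.2 then ⟨2 * l.1 + 2, by omega⟩ else ⟨2 * l.1 + 1, by omega⟩) <| by
    rw [Fintype.bijective_iff_injective_and_card]
    refine ⟨?_, by simp [mul_comm]⟩
    rintro (_ | ⟨i, b⟩) (_ | ⟨j, c⟩) h
    · rfl
    · cases c <;> simp at h
    · cases b <;> simp at h
    · cases b <;> cases c <;> simp [Fin.ext_iff] at h ⊢ <;> omega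

end LinearAlgebra

section WedgePow

variable {𝕜 : Type*} [RCLike 𝕜] {E : Type*} [NormedAddCommGroup E] [NormedSpace 𝕜 E]
  {H : Type*} [TopologicalSpace H] {I : ModelWithCorners 𝕜 E H}
  {M : Type*} [TopologicalSpace M] [ChartedSpace H M]

theorem wedgePow_eq (n : ℕ) (X : VectorField I M) (π : TwoTensorField I M) (x : M)
    (a : Fin (2 * n + 1) → Covector I x) : wedgePow n X π x a =
      MultilinearMap.alternatization
        (pairingForm n (LinearMap.applyₗ (X x) ∘ₗ ContinuousLinearMap.coeLM 𝕜) (π x))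
        fun k => a (pairIndexEquiv n k) := by
  rw [pairingForm_alternatization, wedgePow]
  refine (Fintype.sum_equiv (pairIndexEquiv n).permCongr _ _ fun s => ?_).symm
  have h : ∀ k, (pairIndexEquiv n).permCongr s (pairIndexEquiv n k) = pairIndexEquiv n (s k) :=
    fun k => by simp
  have h0 := h none
  have h1 := fun i => h (some (i, false))
  have h2 := fun i => h (some (i, true))
  rw [Equiv.Perm.sign_permCongr, pairingForm_apply]
  simp only [← h0, ← h1, ← h2]
  rfl

/-- `X ∧ πⁿ` vanishes at no point iff `π + ∂ₜ ∧ X` is nondegenerate. -/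
theorem exists_wedgePow_ne_zero_iff {n : ℕ} [FiniteDimensional 𝕜 E]
    (hE : Module.finrank 𝕜 E = 2 * n + 1) (X : VectorField I M) (π : TwoTensorField I M) (x : M)
    (hπ : (π x).IsAlt) : (∃ a, wedgePow n X π x a ≠ 0) ↔
      ∀ (α : Covector I x) (c : 𝕜), α (X x) = 0 → (∀ β, π x α β = c * β (X x)) → c = 0 ∧ α = 0 := by
  have e : Module.Dual 𝕜 E ≃ₗ[𝕜] (E →L[𝕜] 𝕜) := LinearMap.toContinuousLinearMap
  have hfd : FiniteDimensional 𝕜 (Covector I x) := e.finiteDimensional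
  have hfin : Module.finrank 𝕜 (Covector I x) = 2 * n + 1 := by
    have : Module.finrank 𝕜 (E →L[𝕜] 𝕜) = 2 * n + 1 := by
      rw [← e.finrank_eq, Subspace.dual_finrank_eq, hE]
    exact this
  constructor
  · rintro ⟨a, ha⟩ α c h1 h2
    rw [wedgePow_eq] at ha
    exact eq_zero_of_alternatization_ne_zero hfin hπ ha h1 h2
  · intro h
    obtain ⟨a, ha⟩ := exists_alternatization_ne_zero (n := n) hfin
      (ξ := LinearMap.applyₗ (X x) ∘ₗ ContinuousLinearMap.coeLM 𝕜) hπ h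
    refine ⟨fun k => a ((pairIndexEquiv n).symm k), ?_⟩
    rw [wedgePow_eq]
    simpa using ha

end WedgePow

section EmbeddedAtlas

variable {𝕜 : Type*} [RCLike 𝕜] {E : Type*} [NormedAddCommGroup E] [NormedSpace 𝕜 E]
  {H : Type*} [TopologicalSpace H] {I : ModelWithCorners 𝕜 E H}
  {N : Type*} [TopologicalSpace N] [ChartedSpace H N]
  {F : Type*} [NormedAddCommGroup F] [NormedSpace 𝕜 F] {S : Type*} [TopologicalSpace S]

variable (I F) in
/-- A family of charts on `S`, with values in `F`, that makes `ι : S → N` an embedding of class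
`C^r`: each chart is the restriction of a local `C^r` map on `N`, and has a `C^r` inverse. -/
structure EmbeddedAtlas (r : WithTop ℕ∞) (ι : S → N) where
  chart : S → OpenPartialHomeomorph S F
  mem_source : ∀ σ, σ ∈ (chart σ).source
  extend : S → N → F
  chart_eq : ∀ σ, ∀ q ∈ (chart σ).source, chart σ q = extend σ (ι q)
  contMDiffAt_extend : ∀ σ, ∀ q ∈ (chart σ).source, ContMDiffAt I 𝓘(𝕜, F) r (extend σ) (ι q)
  contMDiffAt_symm : ∀ σ, ∀ v ∈ (chart σ).target,
    ContMDiffAt 𝓘(𝕜, F) I r (fun w => ι ((chart σ).symm w)) v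

variable {r : WithTop ℕ∞} {ι : S → N} (A : EmbeddedAtlas I F r ι)

/-- The charted space structure defined by the atlas. -/
@[reducible]
def EmbeddedAtlas.chartedSpace : ChartedSpace F S where
  atlas := range A.chart
  chartAt := A.chart
  mem_chart_source := A.mem_source
  chart_mem_atlas := mem_range_self

theorem EmbeddedAtlas.isManifold :
    letI := A.chartedSpace
    IsManifold 𝓘(𝕜, F) r S := by
  let _ := A.chartedSpace
  refine isManifold_of_contDiffOn _ _ _ ?_
  rintro _ _ ⟨σ, rfl⟩ ⟨σ', rfl⟩
  intro v hv
  have hv1 : v ∈ (A.chart σ).target := by simp only [mfld_simps] at hv; exact hv.1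
  have hv2 : (A.chart σ).symm v ∈ (A.chart σ').source := by
    simp only [mfld_simps] at hv; exact hv.2
  have h : ContMDiffAt 𝓘(𝕜, F) 𝓘(𝕜, F) r
      (fun w => A.extend σ' (ι ((A.chart σ).symm w))) v :=
    (A.contMDiffAt_extend σ' _ hv2).comp v (A.contMDiffAt_symm σ v hv1)
  have e : (fun w => A.chart σ' ((A.chart σ).symm w)) =ᶠ[𝓝 v]
      fun w => A.extend σ' (ι ((A.chart σ).symm w)) := by
    filter_upwards [((A.chart σ).continuousAt_symm hv1).preimage_mem_nhds
      ((A.chart σ').open_source.mem_nhds hv2)] with w hw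
    exact A.chart_eq σ' _ hw
  exact (h.contDiffAt.congr_of_eventuallyEq e).contDiffWithinAt

theorem EmbeddedAtlas.contMDiff :
    letI := A.chartedSpace
    ContMDiff 𝓘(𝕜, F) I r ι := by
  let _ := A.chartedSpace
  have := A.isManifold
  intro σ
  have h1 : ContMDiffAt 𝓘(𝕜, F) 𝓘(𝕜, F) r (A.chart σ) σ :=
    (contMDiffOn_chart (I := 𝓘(𝕜, F)) (x := σ)).contMDiffAt
      ((A.chart σ).open_source.mem_nhds (A.mem_source σ))
  have h2 := (A.contMDiffAt_symm σ _ ((A.chart σ).map_source (A.mem_source σ))).comp σ h1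
  refine h2.congr_of_eventuallyEq ?_
  filter_upwards [(A.chart σ).open_source.mem_nhds (A.mem_source σ)] with q hq
  simp only [Function.comp_apply]
  rw [(A.chart σ).left_inv hq]

/-- Near every point, `ι` has a left inverse of class `C^r`. -/
theorem EmbeddedAtlas.exists_retraction (σ : S) :
    letI := A.chartedSpace
    ∃ ρ : N → S, ContMDiffAt I 𝓘(𝕜, F) r ρ (ι σ) ∧ ∀ᶠ q in 𝓝 σ, ρ (ι q) = q := by
  let _ := A.chartedSpace
  have := A.isManifold
  refine ⟨fun z => (A.chart σ).symm (A.extend σ z), ?_, ?_⟩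
  · have h1 : ContMDiffAt 𝓘(𝕜, F) 𝓘(𝕜, F) r (A.chart σ).symm (A.extend σ (ι σ)) := by
      refine (contMDiffOn_chart_symm (I := 𝓘(𝕜, F)) (x := σ)).contMDiffAt
        ((A.chart σ).open_target.mem_nhds ?_)
      rw [← A.chart_eq σ σ (A.mem_source σ)]
      exact (A.chart σ).map_source (A.mem_source σ)
    exact h1.comp (ι σ) (A.contMDiffAt_extend σ σ (A.mem_source σ))
  · filter_upwards [(A.chart σ).open_source.mem_nhds (A.mem_source σ)] with q hq
    rw [← A.chart_eq σ q hq, (A.chart σ).left_inv hq]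

/-- A manifold, seen as a manifold modelled on a normed space `F ≃ H`. -/
def EmbeddedAtlas.ofHomeomorph [IsManifold I r N] (e : H ≃ₜ F)
    (he : ContMDiff I 𝓘(𝕜, F) r e) (he' : ContMDiff 𝓘(𝕜, F) I r e.symm) :
    EmbeddedAtlas I F r (id : N → N) where
  chart σ := (chartAt H σ).trans e.toOpenPartialHomeomorph
  mem_source σ := by simp
  extend σ z := e (chartAt H σ z)
  chart_eq σ q hq := rfl
  contMDiffAt_extend σ q hq := by
    have hq' : q ∈ (chartAt H σ).source := by simpa using hq
    exact he.contMDiffAt.comp q ((contMDiffOn_chart (I := I) (x := σ)).contMDiffAt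
      ((chartAt H σ).open_source.mem_nhds hq'))
  contMDiffAt_symm σ v hv := by
    have hv' : e.symm v ∈ (chartAt H σ).target := by simpa using hv
    exact ((contMDiffOn_chart_symm (I := I) (x := σ)).contMDiffAt
      ((chartAt H σ).open_target.mem_nhds hv')).comp v he'.contMDiffAt

end EmbeddedAtlas

/-! Slice charts of the level set of a submersion to `𝕜`. -/

section LevelSet

variable {𝕜 : Type*} [RCLike 𝕜] {E : Type*} [NormedAddCommGroup E] [NormedSpace 𝕜 E]
  [FiniteDimensional 𝕜 E]
  {N : Type*} [TopologicalSpace N] [ChartedSpace E N]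
  {F : Type*} [NormedAddCommGroup F] [NormedSpace 𝕜 F] [FiniteDimensional 𝕜 F]

theorem exists_equiv_fst_eq (hEF : Module.finrank 𝕜 E = Module.finrank 𝕜 F + 1) (l : E →L[𝕜] 𝕜)
    (hl : l ≠ 0) : ∃ A : E ≃L[𝕜] 𝕜 × F, ∀ v, (A v).1 = l v := by
  obtain ⟨v₁, hv₁⟩ : ∃ v, l v ≠ 0 := by
    by_contra! h
    exact hl (ContinuousLinearMap.ext h)
  have hrange : LinearMap.range l.toLinearMap = ⊤ :=
    LinearMap.range_eq_top.2 fun c => ⟨(c * (l v₁)⁻¹) • v₁, by simp [hv₁]⟩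
  have hker : Module.finrank 𝕜 (LinearMap.ker l.toLinearMap) = Module.finrank 𝕜 F := by
    have := LinearMap.finrank_range_add_finrank_ker l.toLinearMap
    rw [hrange, finrank_top, Module.finrank_self, hEF] at this
    omega
  let k : LinearMap.ker l.toLinearMap ≃ₗ[𝕜] F := LinearEquiv.ofFinrankEq _ _ hker
  obtain ⟨P, hP⟩ := (LinearMap.ker l.toLinearMap).exists_isCompl
  let pr := (LinearMap.ker l.toLinearMap).projectionOnto P hP
  let T : E →ₗ[𝕜] 𝕜 × F := l.toLinearMap.prod (k.toLinearMap ∘ₗ pr)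
  have hT : Function.Injective T := by
    rw [← LinearMap.ker_eq_bot, LinearMap.ker_eq_bot']
    intro v hv
    have h1 : l v = 0 := congrArg Prod.fst hv
    have h2 : k (pr v) = 0 := congrArg Prod.snd hv
    have h3 : pr v = 0 := k.map_eq_zero_iff.1 h2
    have h4 : pr v = ⟨v, h1⟩ := Submodule.projectionOnto_apply_left hP (⟨v, h1⟩ : LinearMap.ker l.toLinearMap)
    rw [h3] at h4
    exact congrArg Subtype.val h4.symm
  have hfin : Module.finrank 𝕜 E = Module.finrank 𝕜 (𝕜 × F) := by
    rw [Module.finrank_prod, Module.finrank_self, hEF, add_comm]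
  let A := (LinearEquiv.ofInjectiveOfFinrankEq T hT hfin).toContinuousLinearEquiv
  exact ⟨A, fun v => rfl⟩

/-- Local form of a submersion to `𝕜`. -/
theorem exists_straightening {r : WithTop ℕ∞} (hr : 1 ≤ r) [IsManifold 𝓘(𝕜, E) r N]
    (hEF : Module.finrank 𝕜 E = Module.finrank 𝕜 F + 1) {τ : N → 𝕜}
    (hτ : ContMDiff 𝓘(𝕜, E) 𝓘(𝕜, 𝕜) r τ) (p : N) (hp : diff 𝓘(𝕜, E) τ p ≠ 0) :
    ∃ Ψ : OpenPartialHomeomorph N (𝕜 × F), p ∈ Ψ.source ∧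
      (∀ q ∈ Ψ.source, (Ψ q).1 = τ q) ∧
      (∀ q ∈ Ψ.source, ContMDiffAt 𝓘(𝕜, E) 𝓘(𝕜, 𝕜 × F) r Ψ q) ∧
      ∀ v ∈ Ψ.target, ContMDiffAt 𝓘(𝕜, 𝕜 × F) 𝓘(𝕜, E) r Ψ.symm v := by
  have hr0 : r ≠ 0 := by rintro rfl; simp at hr
  have : IsManifold 𝓘(𝕜, E) 1 N := .of_le hr
  set ψ := chartAt E p with hψ
  have hψsymm : ContMDiffOn 𝓘(𝕜, E) 𝓘(𝕜, E) r ψ.symm ψ.target := contMDiffOn_chart_symm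
  have hψs : ContMDiffOn 𝓘(𝕜, E) 𝓘(𝕜, E) r ψ ψ.source := contMDiffOn_chart
  have hpψ : p ∈ ψ.source := mem_chart_source E p
  have hpt : ψ p ∈ ψ.target := ψ.map_source hpψ
  let t : E → 𝕜 := fun v => τ (ψ.symm v)
  have ht : ∀ v ∈ ψ.target, ContDiffAt 𝕜 r t v := fun v hv =>
    (hτ.contMDiffAt.comp v (hψsymm.contMDiffAt (ψ.open_target.mem_nhds hv))).contDiffAt
  have htd : fderiv 𝕜 t (ψ p) ≠ 0 := by
    intro h0
    apply hp
    have e : τ =ᶠ[𝓝 p] fun q => t (ψ q) := by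
      filter_upwards [ψ.open_source.mem_nhds hpψ] with q hq
      simp only [t]
      rw [ψ.left_inv hq]
    rw [diff_congr e]
    have h1 : HasMFDerivAt 𝓘(𝕜, E) 𝓘(𝕜, 𝕜) t (ψ p) (0 : E →L[𝕜] 𝕜) := by
      rw [← h0]
      exact ((ht _ hpt).differentiableAt hr0).hasFDerivAt.hasMFDerivAt
    have h2 : MDifferentiableAt 𝓘(𝕜, E) 𝓘(𝕜, E) ψ p :=
      (hψs.contMDiffAt (ψ.open_source.mem_nhds hpψ)).mdifferentiableAt hr0
    have h3 := (h1.comp p h2.hasMFDerivAt).mfderiv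
    refine h3.trans ?_
    ext v
    rfl
  obtain ⟨A, hA⟩ := exists_equiv_fst_eq (F := F) hEF (fderiv 𝕜 t (ψ p)) htd
  let L : E →L[𝕜] F := (ContinuousLinearMap.snd 𝕜 𝕜 F).comp (A : E →L[𝕜] 𝕜 × F)
  let g : E → 𝕜 × F := fun v => (t v, L v)
  have hg : ∀ v ∈ ψ.target, ContDiffAt 𝕜 r g v := fun v hv =>
    (ht v hv).prodMk L.contDiff.contDiffAt
  have hgA : HasFDerivAt g (A : E →L[𝕜] 𝕜 × F) (ψ p) := by
    have h1 := ((ht _ hpt).differentiableAt hr0).hasFDerivAt.prodMk (L.hasFDerivAt (x := ψ p))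
    convert! h1 using 1
    ext v
    · simp [hA]
    · rfl
  have : CompleteSpace E := FiniteDimensional.complete 𝕜 E
  let e₀ := (hg _ hpt).toOpenPartialHomeomorph g hgA hr0
  let U : Set E := {v ∈ ψ.target | fderiv 𝕜 g v ∈ range ((↑) : (E ≃L[𝕜] 𝕜 × F) → E →L[𝕜] 𝕜 × F)}
  have hUo : IsOpen U := by
    have hc : ContinuousOn (fderiv 𝕜 g) ψ.target := by
      have : ContDiffOn 𝕜 r g ψ.target := fun v hv => (hg v hv).contDiffWithinAt
      exact this.continuousOn_fderiv_of_isOpen ψ.open_target hr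
    exact hc.isOpen_inter_preimage ψ.open_target ContinuousLinearEquiv.isOpen
  have hpU : ψ p ∈ U := ⟨hpt, A, hgA.fderiv.symm⟩
  let e₁ := e₀.restrOpen U hUo
  have he₁ : ∀ v, e₁ v = g v := fun v => rfl
  have he₁U : ∀ v ∈ e₁.source, v ∈ U := fun v hv => hv.2
  have hsrc : ∀ q ∈ (ψ.trans e₁).source, q ∈ ψ.source ∧ ψ q ∈ e₁.source := by
    intro q hq
    rw [OpenPartialHomeomorph.trans_source] at hq
    exact hq
  refine ⟨ψ.trans e₁, ?_, fun q hq => ?_, fun q hq => ?_, fun v hv => ?_⟩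
  · rw [OpenPartialHomeomorph.trans_source]
    exact ⟨hpψ, (hg _ hpt).mem_toOpenPartialHomeomorph_source hgA hr0, hpU⟩
  · change τ (ψ.symm (ψ q)) = τ q
    rw [ψ.left_inv (hsrc q hq).1]
  · obtain ⟨h1, h2⟩ := hsrc q hq
    exact (hg _ (he₁U _ h2).1).contMDiffAt.comp q (hψs.contMDiffAt (ψ.open_source.mem_nhds h1))
  · rw [OpenPartialHomeomorph.trans_target] at hv
    obtain ⟨h1, h2⟩ := hv
    have h3 := he₁U _ (e₁.map_target h1)
    obtain ⟨B, hB⟩ := h3.2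
    have h4 : ContDiffAt 𝕜 r e₁.symm v := by
      refine e₁.contDiffAt_symm h1 (f₀' := B) ?_ (hg _ h3.1)
      rw [hB]
      exact ((hg _ h3.1).differentiableAt hr0).hasFDerivAt
    exact (hψsymm.contMDiffAt (ψ.open_target.mem_nhds h2)).comp v h4.contMDiffAt

/-- Slice charts on a regular level set. -/
def EmbeddedAtlas.ofLevelSet (r : WithTop ℕ∞) {τ : N → 𝕜}
    (Ψ : {p : N // τ p = 0} → OpenPartialHomeomorph N (𝕜 × F))
    (hmem : ∀ σ, (σ : N) ∈ (Ψ σ).source)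
    (hfst : ∀ σ, ∀ q ∈ (Ψ σ).source, (Ψ σ q).1 = τ q)
    (hsm : ∀ σ, ∀ q ∈ (Ψ σ).source, ContMDiffAt 𝓘(𝕜, E) 𝓘(𝕜, 𝕜 × F) r (Ψ σ) q)
    (hsymm : ∀ σ, ∀ v ∈ (Ψ σ).target, ContMDiffAt 𝓘(𝕜, 𝕜 × F) 𝓘(𝕜, E) r (Ψ σ).symm v) :
    EmbeddedAtlas 𝓘(𝕜, E) F r (Subtype.val : {p : N // τ p = 0} → N) := by
  classical
  have hz : ∀ σ, ∀ v : F, ((0 : 𝕜), v) ∈ (Ψ σ).target → τ ((Ψ σ).symm (0, v)) = 0 :=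
    fun σ v hv => by rw [← hfst σ _ ((Ψ σ).map_target hv), (Ψ σ).right_inv hv]
  have hq : ∀ σ, ∀ q : {p : N // τ p = 0}, (q : N) ∈ (Ψ σ).source →
      ((0 : 𝕜), (Ψ σ q).2) = Ψ σ q := fun σ q hq =>
    Prod.ext ((hfst σ _ hq).trans q.2).symm rfl
  exact {
    chart := fun σ =>
      { toFun := fun q => (Ψ σ q).2
        invFun := fun v => if h : τ ((Ψ σ).symm (0, v)) = 0 then ⟨_, h⟩ else σ
        source := {q | (q : N) ∈ (Ψ σ).source}
        target := {v | ((0 : 𝕜), v) ∈ (Ψ σ).target}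
        map_source' := fun q h => by
          change ((0 : 𝕜), (Ψ σ q).2) ∈ (Ψ σ).target
          rw [hq σ q h]
          exact (Ψ σ).map_source h
        map_target' := fun v h => by
          rw [dif_pos (hz σ v h)]
          exact (Ψ σ).map_target h
        left_inv' := fun q h => by
          have h1 : (Ψ σ).symm ((0 : 𝕜), (Ψ σ q).2) = q := by
            rw [hq σ q h, (Ψ σ).left_inv h]
          rw [dif_pos (by rw [h1]; exact q.2)]
          exact Subtype.ext h1
        right_inv' := fun v h => by
          rw [dif_pos (hz σ v h)]
          exact congrArg Prod.snd ((Ψ σ).right_inv h)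
        open_source := (Ψ σ).open_source.preimage continuous_subtype_val
        open_target := (Ψ σ).open_target.preimage (by fun_prop)
        continuousOn_toFun := continuous_snd.comp_continuousOn
          ((Ψ σ).continuousOn.comp continuous_subtype_val.continuousOn fun q h => h)
        continuousOn_invFun := by
          refine (Topology.IsInducing.continuousOn_iff
            (g := (Subtype.val : {p : N // τ p = 0} → N)) ⟨rfl⟩).2 ?_
          refine ContinuousOn.congr (f := fun v => (Ψ σ).symm ((0 : 𝕜), v)) ?_ fun v h => ?_
          · exact (Ψ σ).continuousOn_symm.comp (by fun_prop) fun v h => h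
          · simp only [Function.comp_apply]
            rw [dif_pos (hz σ v h)] }
    mem_source := hmem
    extend := fun σ z => (Ψ σ z).2
    chart_eq := fun σ q h => rfl
    contMDiffAt_extend := fun σ q h =>
      (contDiff_snd.contMDiff.contMDiffAt).comp (q : N) (hsm σ q h)
    contMDiffAt_symm := fun σ v h => by
      have h1 : ContMDiffAt 𝓘(𝕜, F) 𝓘(𝕜, E) r (fun w => (Ψ σ).symm ((0 : 𝕜), w)) v :=
        (hsymm σ _ h).comp v (contDiff_prodMk_right (0 : 𝕜)).contMDiff.contMDiffAt
      refine h1.congr_of_eventuallyEq ?_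
      have ho : IsOpen {v : F | ((0 : 𝕜), v) ∈ (Ψ σ).target} :=
        (Ψ σ).open_target.preimage (by fun_prop)
      filter_upwards [ho.mem_nhds h] with w hw
      change ((if h : τ ((Ψ σ).symm (0, w)) = 0 then ⟨_, h⟩ else σ : {p : N // τ p = 0}) : N) = _
      rw [dif_pos (hz σ w hw)] }

theorem nonempty_embeddedAtlas_levelSet {r : WithTop ℕ∞} (hr : 1 ≤ r) [IsManifold 𝓘(𝕜, E) r N]
    (hEF : Module.finrank 𝕜 E = Module.finrank 𝕜 F + 1) {τ : N → 𝕜}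
    (hτ : ContMDiff 𝓘(𝕜, E) 𝓘(𝕜, 𝕜) r τ) (hreg : ∀ p, diff 𝓘(𝕜, E) τ p ≠ 0) :
    Nonempty (EmbeddedAtlas 𝓘(𝕜, E) F r (Subtype.val : {p : N // τ p = 0} → N)) := by
  choose Ψ h1 h2 h3 h4 using fun p => exists_straightening (F := F) hr hEF hτ p (hreg p)
  exact ⟨.ofLevelSet r (fun σ => Ψ σ) (fun σ => h1 σ) (fun σ => h2 σ)
    (fun σ => h3 σ) fun σ => h4 σ⟩

end LevelSet

section Transport

variable {𝕜 : Type*} [RCLike 𝕜] {E : Type*} [NormedAddCommGroup E] [NormedSpace 𝕜 E]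
  {H : Type*} [TopologicalSpace H] {I : ModelWithCorners 𝕜 E H}
  {N : Type*} [TopologicalSpace N] [ChartedSpace H N]
  {E' : Type*} [NormedAddCommGroup E'] [NormedSpace 𝕜 E']
  {H' : Type*} [TopologicalSpace H'] {I' : ModelWithCorners 𝕜 E' H'}
  {N' : Type*} [TopologicalSpace N'] [ChartedSpace H' N']

variable (I I') in
/-- Mutually inverse differentiable maps. -/
structure IsDiffeoPair (r : WithTop ℕ∞) (Φ : N' → N) (Θ : N → N') : Prop where
  contMDiff : ContMDiff I' I r Φ
  contMDiff_inv : ContMDiff I I' r Θ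
  left_inv : ∀ x, Θ (Φ x) = x
  right_inv : ∀ y, Φ (Θ y) = y

variable {r : WithTop ℕ∞} {Φ : N' → N} {Θ : N → N'}

variable (I I' Φ Θ) in
/-- The differential of the inverse `Θ` of `Φ`, at `Φ x`. -/
def tangentBack (x : N') : TangentSpace I (Φ x) →L[𝕜] TangentSpace I' x :=
  (mfderiv I I' Θ (Φ x) : E →L[𝕜] E')

variable (I I' Φ Θ) in
/-- The 2-tensor field on `N'` that corresponds to `π` under `Φ : N' ≃ N`. -/
def TwoTensorField.transport (π : TwoTensorField I N) : TwoTensorField I' N' := fun x =>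
  let b : Covector I' x →ₗ[𝕜] Covector I (Φ x) :=
    { toFun := fun α => α.comp (tangentBack I I' Φ Θ x)
      map_add' := fun _ _ => rfl
      map_smul' := fun _ _ => rfl }
  (π (Φ x)).compl₁₂ b b

theorem TwoTensorField.transport_apply (π : TwoTensorField I N) (x : N') (α β : Covector I' x) :
    π.transport I I' Φ Θ x α β =
      π (Φ x) (α.comp (tangentBack I I' Φ Θ x)) (β.comp (tangentBack I I' Φ Θ x)) := rfl

variable (I I' Φ Θ) in
/-- The vector field on `N'` that corresponds to `Z` under `Φ : N' ≃ N`. -/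
def VectorField.transport (Z : VectorField I N) : VectorField I' N' := fun x =>
  tangentBack I I' Φ Θ x (Z (Φ x))

theorem diff_comp_eq {f : N' → 𝕜} {x : N'} {y : N} (h : Θ y = x)
    (hf : MDifferentiableAt I' 𝓘(𝕜, 𝕜) f x) (hΘ : MDifferentiableAt I I' Θ y) :
    (diff I (fun z => f (Θ z)) y : E →L[𝕜] 𝕜) =
      ContinuousLinearMap.comp (diff I' f x : E' →L[𝕜] 𝕜) (mfderiv I I' Θ y : E →L[𝕜] E') := by
  subst h
  exact (hf.hasMFDerivAt.comp y hΘ.hasMFDerivAt).mfderiv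

namespace IsDiffeoPair

variable (h : IsDiffeoPair I I' r Φ Θ) (hr : r ≠ 0)
include h hr

theorem diff_comp (f : N' → 𝕜) (x : N') :
    (diff I' f x).comp (tangentBack I I' Φ Θ x) = diff I (fun z => f (Θ z)) (Φ x) := by
  have hΘ : MDifferentiableAt I I' Θ (Φ x) := (h.contMDiff_inv _).mdifferentiableAt hr
  by_cases hf : MDifferentiableAt I' 𝓘(𝕜, 𝕜) f x
  · exact (diff_comp_eq (h.left_inv x) hf hΘ).symm
  · have hf' : ¬ MDifferentiableAt I 𝓘(𝕜, 𝕜) (fun z => f (Θ z)) (Φ x) := by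
      intro h'
      have h2 := h'.comp x ((h.contMDiff x).mdifferentiableAt hr)
      have e : (fun z => f (Θ z)) ∘ Φ = f := funext fun x => congrArg f (h.left_inv x)
      rw [e] at h2
      exact hf h2
    rw [diff, diff, mfderiv_zero_of_not_mdifferentiableAt hf,
      mfderiv_zero_of_not_mdifferentiableAt hf']
    rfl

theorem mfderiv_tangentBack (x : N') (v : TangentSpace I (Φ x)) :
    mfderiv I' I Φ x (tangentBack I I' Φ Θ x v) = v := by
  have hΘ : MDifferentiableAt I I' Θ (Φ x) := (h.contMDiff_inv _).mdifferentiableAt hr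
  have key : ∀ x' (hx' : Θ (Φ x) = x'), (ContinuousLinearMap.comp
      (mfderiv I' I Φ x' : E' →L[𝕜] E) (mfderiv I I' Θ (Φ x) : E →L[𝕜] E')) =
        ContinuousLinearMap.id 𝕜 E := by
    rintro _ rfl
    have h1 : MDifferentiableAt I' I Φ (Θ (Φ x)) := (h.contMDiff _).mdifferentiableAt hr
    have h2 := (h1.hasMFDerivAt.comp (Φ x) hΘ.hasMFDerivAt).mfderiv
    have e : Φ ∘ Θ = id := funext h.right_inv
    rw [e, mfderiv_id] at h2
    exact h2.symm
  exact congrArg (fun L : E →L[𝕜] E => L v) (key x (h.left_inv x))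

theorem tangentBack_mfderiv (x : N') (v : TangentSpace I' x) :
    tangentBack I I' Φ Θ x (mfderiv I' I Φ x v) = v := by
  have h1 : MDifferentiableAt I I' Θ (Φ x) := (h.contMDiff_inv _).mdifferentiableAt hr
  have h2 : MDifferentiableAt I' I Φ x := (h.contMDiff _).mdifferentiableAt hr
  have h3 := (h1.hasMFDerivAt.comp x h2.hasMFDerivAt).mfderiv
  have e : Θ ∘ Φ = id := funext h.left_inv
  rw [e, mfderiv_id] at h3
  exact congrArg (fun L : E' →L[𝕜] E' => L v) h3.symm

theorem onFun_transport (π : TwoTensorField I N) (f g : N' → 𝕜) :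
    (π.transport I I' Φ Θ).onFun f g =
      fun x => π.onFun (fun z => f (Θ z)) (fun z => g (Θ z)) (Φ x) := by
  funext x
  rw [TwoTensorField.onFun, TwoTensorField.transport_apply, h.diff_comp hr, h.diff_comp hr]
  rfl

theorem onFun_transport_comp (π : TwoTensorField I N) (f g : N' → 𝕜) :
    (fun y => (π.transport I I' Φ Θ).onFun f g (Θ y)) =
      π.onFun (fun z => f (Θ z)) (fun z => g (Θ z)) := by
  rw [h.onFun_transport hr]
  funext y
  simp only [h.right_inv]

theorem vectorField_onFun_transport (Z : VectorField I N) (f : N' → 𝕜) :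
    (Z.transport I I' Φ Θ).onFun f = fun x => Z.onFun (fun z => f (Θ z)) (Φ x) := by
  funext x
  rw [VectorField.onFun, VectorField.onFun, ← h.diff_comp hr]
  rfl

theorem vectorField_onFun_transport_comp (Z : VectorField I N) (f : N' → 𝕜) :
    (fun y => (Z.transport I I' Φ Θ).onFun f (Θ y)) = Z.onFun (fun z => f (Θ z)) := by
  rw [h.vectorField_onFun_transport hr]
  funext y
  simp only [h.right_inv]

theorem isHomogeneousSymplectic {π : TwoTensorField I N} {Z : VectorField I N}
    (hπ : IsHomogeneousSymplectic r π Z) :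
    IsHomogeneousSymplectic r (π.transport I I' Φ Θ) (Z.transport I I' Φ Θ) := by
  have hback : ∀ {x : N'} {f : N' → 𝕜}, ContMDiffAt I' 𝓘(𝕜, 𝕜) r f x →
      ContMDiffAt I 𝓘(𝕜, 𝕜) r (fun z => f (Θ z)) (Φ x) := by
    intro x f hf
    rw [← h.left_inv x] at hf
    exact hf.comp (Φ x) (h.contMDiff_inv _)
  have halt : ∀ x, (π.transport I I' Φ Θ x).IsAlt := fun x α => hπ.alt (Φ x) _
  refine ⟨⟨⟨halt, fun x f g hf hg => ?_, fun x f g k hf hg hk => ?_⟩,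
    fun x f hf => ?_, fun x => ?_, fun x f g hf hg => ?_⟩, fun x => ?_⟩
  · rw [h.onFun_transport hr]
    exact (hπ.smooth (Φ x) _ _ (hback hf) (hback hg)).comp x (h.contMDiff x)
  · have := hπ.schouten (Φ x) _ _ _ (hback hf) (hback hg) (hback hk)
    simp only [schoutenSelf] at this ⊢
    rw [h.onFun_transport hr _ ((π.transport I I' Φ Θ).onFun f g) k,
      h.onFun_transport hr _ ((π.transport I I' Φ Θ).onFun g k) f,
      h.onFun_transport hr _ ((π.transport I I' Φ Θ).onFun k f) g]
    simp only [h.onFun_transport_comp hr]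
    exact this
  · rw [h.vectorField_onFun_transport hr]
    exact (hπ.smooth_vectorField (Φ x) _ (hback hf)).comp x (h.contMDiff x)
  · obtain ⟨γ, hγ0, hγ⟩ := hπ.complete (Φ x)
    refine ⟨fun t => Θ (γ t), by simp only [hγ0, h.left_inv], fun t => ?_⟩
    have h1 : MDifferentiableAt I I' Θ (γ t) := (h.contMDiff_inv _).mdifferentiableAt hr
    have h2 := h1.hasMFDerivAt.comp t (hγ t)
    refine h2.congr_mfderiv ?_
    have e : ∀ y (hy : Φ (Θ (γ t)) = y), (mfderiv I I' Θ y : E →L[𝕜] E') (Z y : E) =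
        (Z.transport I I' Φ Θ (Θ (γ t)) : E') := by
      rintro _ rfl; rfl
    have e' := e (γ t) (h.right_inv _)
    refine ContinuousLinearMap.ext fun (s : 𝕜) => ?_
    change (mfderiv I I' Θ (γ t) : E →L[𝕜] E') (s • (Z (γ t) : E)) =
      s • (Z.transport I I' Φ Θ (Θ (γ t)) : E')
    rw [map_smul, e']
  · have := hπ.homogeneous (Φ x) _ _ (hback hf) (hback hg)
    simp only [lieDerivative] at this ⊢
    rw [h.vectorField_onFun_transport hr Z ((π.transport I I' Φ Θ).onFun f g),
      h.onFun_transport hr _ ((Z.transport I I' Φ Θ).onFun f) g,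
      h.onFun_transport hr _ f ((Z.transport I I' Φ Θ).onFun g)]
    simp only [h.onFun_transport_comp hr, h.vectorField_onFun_transport_comp hr]
    rw [h.onFun_transport hr]
    exact this
  · refine ((halt x).isRefl.nondegenerate_iff_separatingLeft).2 fun α hα => ?_
    have h1 : α.comp (tangentBack I I' Φ Θ x) = 0 := by
      refine (hπ.nondegenerate (Φ x)).1 _ fun γ => ?_
      have := hα (γ.comp (mfderiv I' I Φ x))
      rw [TwoTensorField.transport_apply] at this
      have e : (γ.comp (mfderiv I' I Φ x)).comp (tangentBack I I' Φ Θ x) = γ := by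
        ext v
        exact congrArg γ (h.mfderiv_tangentBack hr x v)
      rwa [e] at this
    ext v
    have := congrArg (fun L : Covector I (Φ x) => L (mfderiv I' I Φ x v)) h1
    change α (tangentBack I I' Φ Θ x (mfderiv I' I Φ x v)) = 0 at this
    rwa [h.tangentBack_mfderiv hr] at this

variable {E₂ : Type*} [NormedAddCommGroup E₂] [NormedSpace 𝕜 E₂]
  {H₂ : Type*} [TopologicalSpace H₂] {I₂ : ModelWithCorners 𝕜 E₂ H₂}
  {M : Type*} [TopologicalSpace M] [ChartedSpace H₂ M]

theorem mfderiv_comp_apply {φ : N → M} (hφ : ContMDiff I I₂ r φ) (x : N') (v : TangentSpace I' x) :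
    mfderiv I' I₂ (fun z => φ (Φ z)) x v = mfderiv I I₂ φ (Φ x) (mfderiv I' I Φ x v) := by
  have h1 := ((hφ (Φ x)).mdifferentiableAt hr).hasMFDerivAt
  have h2 := ((h.contMDiff x).mdifferentiableAt hr).hasMFDerivAt
  exact congrArg (fun L : E' →L[𝕜] E₂ => L v) (h1.comp x h2).mfderiv

theorem projectsTo {π : TwoTensorField I N} {φ : N → M} (hφ : ContMDiff I I₂ r φ)
    {ρ : TwoTensorField I₂ M} (hπ : π.ProjectsTo φ ρ) :
    (π.transport I I' Φ Θ).ProjectsTo (fun z => φ (Φ z)) ρ := by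
  intro x α β
  rw [← hπ (Φ x) α β, TwoTensorField.transport_apply]
  have e : ∀ α : Covector I₂ (φ (Φ x)), (α.comp (mfderiv I' I₂ (fun z => φ (Φ z)) x)).comp
      (tangentBack I I' Φ Θ x) = α.comp (mfderiv I I₂ φ (Φ x)) := by
    intro α
    ext v
    have := h.mfderiv_comp_apply hr hφ x (tangentBack I I' Φ Θ x v)
    rw [h.mfderiv_tangentBack hr] at this
    exact congrArg α this
  rw [e, e]

theorem vectorField_projectsTo {Z : VectorField I N} {φ : N → M} (hφ : ContMDiff I I₂ r φ)
    {Y : VectorField I₂ M} (hZ : Z.ProjectsTo φ Y) :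
    (Z.transport I I' Φ Θ).ProjectsTo (fun z => φ (Φ z)) Y := by
  intro x
  have := h.mfderiv_comp_apply hr hφ x (tangentBack I I' Φ Θ x (Z (Φ x)))
  rw [h.mfderiv_tangentBack hr] at this
  exact this.trans (hZ (Φ x))

end IsDiffeoPair

end Transport

/-! The Poissonification of a contact resolution. -/

section ContactToSymplectic

variable {𝕜 : Type*} [RCLike 𝕜] {E : Type*} [NormedAddCommGroup E] [NormedSpace 𝕜 E]
  {H : Type*} [TopologicalSpace H] {I : ModelWithCorners 𝕜 E H}
  {S : Type*} [TopologicalSpace S] [ChartedSpace H S]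
  {E₂ : Type*} [NormedAddCommGroup E₂] [NormedSpace 𝕜 E₂]
  {H₂ : Type*} [TopologicalSpace H₂] {I₂ : ModelWithCorners 𝕜 E₂ H₂}
  {M : Type*} [TopologicalSpace M] [ChartedSpace H₂ M] {r : WithTop ℕ∞}

theorem IsContact.isHomogeneousSymplectic [FiniteDimensional 𝕜 E] [I.Boundaryless]
    (hr : r = ∞ ∨ r = ω) [IsManifold I r S] {n : ℕ} (hE : Module.finrank 𝕜 E = 2 * n + 1)
    {π : TwoTensorField I S} {X : VectorField I S} (hC : IsContact r n π X) :
    IsHomogeneousSymplectic r (poissonification π X) (poissonificationField I S) := by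
  have hP := hC.toIsJacobi.isHomogeneousPoisson hr
  refine ⟨hP, fun p => ?_⟩
  refine ((hP.alt p).isRefl.nondegenerate_iff_separatingLeft).2 fun γ hγ => ?_
  have h := (exists_wedgePow_ne_zero_iff hE X π p.2 (hC.alt _)).1 (hC.wedgePow_ne_zero p.2)
  rw [eq_prodCovector p γ] at hγ ⊢
  set s := γ (poissonificationField I S p)
  set α := covectorRestr I p γ
  have key : ∀ t β, π p.2 α β + s * β (X p.2) - t * α (X p.2) = 0 := fun t β => by
    have := hγ (prodCovector I p t β)
    rw [poissonification_prodCovector] at this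
    exact (mul_eq_zero.1 this).resolve_left (exp_inv_ne_zero _)
  have h0 : α (X p.2) = 0 := by simpa using key 1 0
  obtain ⟨h1, h2⟩ := h α (-s) h0 fun β => by
    have := key 0 β
    rw [zero_mul, sub_zero] at this
    rw [neg_mul]
    exact eq_neg_of_add_eq_zero_left this
  rw [neg_eq_zero.1 h1, h2]
  ext v
  rw [prodCovector_apply, zero_mul, zero_add]
  rfl

/-- The map `id × φ`. -/
theorem contMDiff_id_prod {φ : S → M} (hφ : ContMDiff I I₂ r φ) :
    ContMDiff (𝓘(𝕜, 𝕜).prod I) (𝓘(𝕜, 𝕜).prod I₂) r fun p : 𝕜 × S => (p.1, φ p.2) :=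
  contMDiff_fst.prodMk (hφ.comp contMDiff_snd)

theorem mfderiv_id_prod {φ : S → M} {p : 𝕜 × S} (hφ : MDifferentiableAt I I₂ φ p.2)
    (v : TangentSpace (𝓘(𝕜, 𝕜).prod I) p) :
    mfderiv (𝓘(𝕜, 𝕜).prod I) (𝓘(𝕜, 𝕜).prod I₂) (fun p : 𝕜 × S => (p.1, φ p.2)) p v =
      (v.1, mfderiv I I₂ φ p.2 v.2) := by
  have h := (hasMFDerivAt_fst (I := 𝓘(𝕜, 𝕜)) (I' := I) p).prodMk
    (hφ.hasMFDerivAt.comp p (hasMFDerivAt_snd (I := 𝓘(𝕜, 𝕜)) (I' := I) p))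
  exact congrArg (fun L : 𝕜 × E →L[𝕜] 𝕜 × E₂ => L v) h.mfderiv

theorem poissonification_projectsTo {φ : S → M} (hr : r ≠ 0) (hφ : ContMDiff I I₂ r φ)
    {π : TwoTensorField I S} {X : VectorField I S} {ρ : TwoTensorField I₂ M} {Y : VectorField I₂ M}
    (hπ : π.ProjectsTo φ ρ) (hX : X.ProjectsTo φ Y) :
    (poissonification π X).ProjectsTo (fun p : 𝕜 × S => (p.1, φ p.2)) (poissonification ρ Y) := by
  intro p α β
  have e : ∀ γ : Covector (𝓘(𝕜, 𝕜).prod I₂) (p.1, φ p.2),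
      γ.comp (mfderiv (𝓘(𝕜, 𝕜).prod I) (𝓘(𝕜, 𝕜).prod I₂) (fun p : 𝕜 × S => (p.1, φ p.2)) p) =
        prodCovector I p (γ (poissonificationField I₂ M (p.1, φ p.2)))
          ((covectorRestr I₂ (p.1, φ p.2) γ).comp (mfderiv I I₂ φ p.2)) := by
    intro γ
    ext v
    have h1 := mfderiv_id_prod (𝕜 := 𝕜) (p := p) ((hφ p.2).mdifferentiableAt hr) v
    have h2 := congrArg (fun L : Covector (𝓘(𝕜, 𝕜).prod I₂) (p.1, φ p.2) =>
      L (mfderiv (𝓘(𝕜, 𝕜).prod I) (𝓘(𝕜, 𝕜).prod I₂) (fun p : 𝕜 × S => (p.1, φ p.2)) p v))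
      (eq_prodCovector (p.1, φ p.2) γ)
    refine h2.trans ?_
    dsimp only
    rw [prodCovector_apply, prodCovector_apply, h1]
    rfl
  rw [e, e, poissonification_prodCovector]
  conv_rhs => rw [eq_prodCovector _ α, eq_prodCovector _ β, poissonification_prodCovector]
  rw [← hπ p.2, ← hX p.2]
  rfl

theorem poissonificationField_projectsTo {φ : S → M} (hr : r ≠ 0) (hφ : ContMDiff I I₂ r φ) :
    (poissonificationField I S).ProjectsTo (fun p : 𝕜 × S => (p.1, φ p.2))
      (poissonificationField I₂ M) := by
  intro p
  rw [mfderiv_id_prod ((hφ p.2).mdifferentiableAt hr)]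
  change ((1 : 𝕜), mfderiv I I₂ φ p.2 0) = ((1 : 𝕜), (0 : E₂))
  rw [map_zero]
  rfl

end ContactToSymplectic

section ContactResolution

universe u

variable {𝕜 : Type} [RCLike 𝕜] {E : Type*} [NormedAddCommGroup E] [NormedSpace 𝕜 E]
  {H : Type*} [TopologicalSpace H] {I : ModelWithCorners 𝕜 E H}
  {M : Type u} [TopologicalSpace M] [ChartedSpace H M]

/-- The Poissonification of a Jacobi manifold with a contact resolution has a homogeneous symplectic
resolution. -/
theorem AdmitsContactResolution.admitsHomogeneousSymplecticResolution {r : WithTop ℕ∞}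
    (hr : r = ∞ ∨ r = ω) {n : ℕ} {π : TwoTensorField I M} {X : VectorField I M}
    (h : AdmitsContactResolution r n π X) :
    AdmitsHomogeneousSymplecticResolution r (2 * n + 2) (poissonification π X)
      (poissonificationField I M) := by
  obtain ⟨S, _, _, _, _, πS, XS, φ, hC, hφ, hπ, hX, hsurj⟩ := h
  have h1 := one_le_of_eq hr
  have hr0 : r ≠ 0 := by rintro rfl; simp at h1
  let e : (𝕜 × EuclideanSpace 𝕜 (Fin (2 * n + 1))) ≃L[𝕜] EuclideanSpace 𝕜 (Fin (2 * n + 2)) :=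
    ContinuousLinearEquiv.ofFinrankEq (by simp; ring)
  have he : ContMDiff 𝓘(𝕜, 𝕜 × EuclideanSpace 𝕜 (Fin (2 * n + 1)))
      𝓘(𝕜, EuclideanSpace 𝕜 (Fin (2 * n + 2))) r e := e.contDiff.contMDiff
  have he' : ContMDiff 𝓘(𝕜, EuclideanSpace 𝕜 (Fin (2 * n + 2)))
      𝓘(𝕜, 𝕜 × EuclideanSpace 𝕜 (Fin (2 * n + 1))) r e.symm := e.symm.contDiff.contMDiff
  rw [modelWithCornersSelf_prod] at he he'
  let A := EmbeddedAtlas.ofHomeomorph (N := 𝕜 × S)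
    (I := 𝓘(𝕜, 𝕜).prod 𝓘(𝕜, EuclideanSpace 𝕜 (Fin (2 * n + 1)))) (r := r)
    e.toHomeomorph he he'
  let _ : ChartedSpace (EuclideanSpace 𝕜 (Fin (2 * n + 2))) (𝕜 × S) := A.chartedSpace
  have : IsManifold 𝓘(𝕜, EuclideanSpace 𝕜 (Fin (2 * n + 2))) r (𝕜 × S) := A.isManifold
  have hD : IsDiffeoPair (𝓘(𝕜, 𝕜).prod 𝓘(𝕜, EuclideanSpace 𝕜 (Fin (2 * n + 1))))
      𝓘(𝕜, EuclideanSpace 𝕜 (Fin (2 * n + 2))) r (id : 𝕜 × S → 𝕜 × S) id := by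
    refine ⟨A.contMDiff, fun p => ?_, fun _ => rfl, fun _ => rfl⟩
    obtain ⟨ρ, hρ, hid⟩ := A.exists_retraction p
    exact hρ.congr_of_eventuallyEq (hid.mono fun q hq => hq.symm)
  have hS := hC.isHomogeneousSymplectic hr (by simp)
  have hφ' := contMDiff_id_prod (𝕜 := 𝕜) hφ
  refine ⟨𝕜 × S, inferInstance, inferInstance, A.chartedSpace, A.isManifold, _, _,
    fun p => (p.1, φ p.2), hD.isHomogeneousSymplectic hr0 hS, hφ'.comp A.contMDiff,
    hD.projectsTo hr0 hφ' (poissonification_projectsTo hr0 hφ hπ hX),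
    hD.vectorField_projectsTo hr0 hφ' (poissonificationField_projectsTo hr0 hφ), ?_⟩
  rintro ⟨t, y⟩
  obtain ⟨x, rfl⟩ := hsurj y
  exact ⟨(t, x), rfl⟩

end ContactResolution

section Slice

variable {𝕜 : Type*} [RCLike 𝕜] {E : Type*} [NormedAddCommGroup E] [NormedSpace 𝕜 E]
  {H : Type*} [TopologicalSpace H] {I : ModelWithCorners 𝕜 E H}
  {N : Type*} [TopologicalSpace N] [ChartedSpace H N]
  {F : Type*} [NormedAddCommGroup F] [NormedSpace 𝕜 F]
  {G : Type*} [TopologicalSpace G] {J : ModelWithCorners 𝕜 F G}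
  {S : Type*} [TopologicalSpace S] [ChartedSpace G S]

/-- `ι : S → N` is a slice `τ = 0` of a vector field `Z` with `Z[τ] = 1`, and `pr σ` is the
projection of `T_(ι σ) N` onto `T_σ S` along `Z`. -/
structure IsSlice (r : WithTop ℕ∞) (ι : S → N) (τ : N → 𝕜) (Z : VectorField I N)
    (pr : ∀ σ, TangentSpace I (ι σ) →L[𝕜] TangentSpace J σ) : Prop where
  contMDiff : ContMDiff J I r ι
  contMDiff_time : ContMDiff I 𝓘(𝕜, 𝕜) r τ
  time_eq : ∀ σ, τ (ι σ) = 0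
  onFun_time : ∀ p, Z.onFun τ p = 1
  pr_mfderiv : ∀ σ v, pr σ (mfderiv J I ι σ v) = v
  mfderiv_pr : ∀ σ v, mfderiv J I ι σ (pr σ v) = v - diff I τ (ι σ) v • Z (ι σ)
  exists_retraction : ∀ σ, ∃ ρ : N → S, ContMDiffAt I J r ρ (ι σ) ∧ ∀ᶠ q in 𝓝 σ, ρ (ι q) = q

variable {r : WithTop ℕ∞} {ι : S → N} {τ : N → 𝕜} {Z : VectorField I N}
  {pr : ∀ σ, TangentSpace I (ι σ) →L[𝕜] TangentSpace J σ}

/-- The bivector field induced on a slice. -/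
def TwoTensorField.slice (π : TwoTensorField I N)
    (pr : ∀ σ, TangentSpace I (ι σ) →L[𝕜] TangentSpace J σ) : TwoTensorField J S := fun σ =>
  let b : Covector J σ →ₗ[𝕜] Covector I (ι σ) :=
    { toFun := fun α => α.comp (pr σ)
      map_add' := fun _ _ => rfl
      map_smul' := fun _ _ => rfl }
  (π (ι σ)).compl₁₂ b b

theorem TwoTensorField.slice_apply (π : TwoTensorField I N) (σ : S) (α β : Covector J σ) :
    π.slice pr σ α β = π (ι σ) (α.comp (pr σ)) (β.comp (pr σ)) := rfl

/-- The vector field induced on a slice by `π(dτ, ·)`. -/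
def TwoTensorField.sliceField [FiniteDimensional 𝕜 F] (π : TwoTensorField I N) (τ : N → 𝕜)
    (pr : ∀ σ, TangentSpace I (ι σ) →L[𝕜] TangentSpace J σ) : VectorField J S := fun σ =>
  (exists_tangentVector (I := J) (x := σ) (π (ι σ) (diff I τ (ι σ)) ∘ₗ
    { toFun := fun α => α.comp (pr σ)
      map_add' := fun _ _ => rfl
      map_smul' := fun _ _ => rfl })).choose

theorem TwoTensorField.apply_sliceField [FiniteDimensional 𝕜 F] (π : TwoTensorField I N) (σ : S)
    (α : Covector J σ) :
    α (π.sliceField τ pr σ) = π (ι σ) (diff I τ (ι σ)) (α.comp (pr σ)) :=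
  (exists_tangentVector (I := J) (x := σ) (π (ι σ) (diff I τ (ι σ)) ∘ₗ
    { toFun := fun α => α.comp (pr σ)
      map_add' := fun _ _ => rfl
      map_smul' := fun _ _ => rfl })).choose_spec α

theorem sub_zero_smul_covector {x : N} (α β : Covector I x) : α - (0 : 𝕜) • β = α := by
  ext v
  change α v - 0 * β v = α v
  rw [zero_mul, sub_zero]

/-- `L_Z π = -π` on functions `F` with `d (Z[F]) = 0`. -/
theorem IsHomogeneousPoisson.onFun_onFun_eq_neg {π : TwoTensorField I N} {x : N}
    (hπ : IsHomogeneousPoisson r π Z)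
    {F G : N → 𝕜} (hF : ContMDiffAt I 𝓘(𝕜, 𝕜) r F x) (hG : ContMDiffAt I 𝓘(𝕜, 𝕜) r G x)
    (hZF : diff I (Z.onFun F) x = 0) (hZG : diff I (Z.onFun G) x = 0) :
    Z.onFun (π.onFun F G) x = - π.onFun F G x := by
  have := hπ.homogeneous _ F G hF hG
  have h1 : π.onFun (Z.onFun F) G x = 0 := by
    rw [TwoTensorField.onFun, hZF, map_zero, LinearMap.zero_apply]
  have h2 : π.onFun F (Z.onFun G) x = 0 := by
    rw [TwoTensorField.onFun, hZG, map_zero]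
  rw [lieDerivative, h1, h2, sub_zero, sub_zero] at this
  exact this

variable (I Z) in
/-- `F` extends `f` near `σ`, and is constant along `Z` to second order. -/
structure IsFlatExtension (r : WithTop ℕ∞) (ι : S → N) (σ : S) (f : S → 𝕜) (F : N → 𝕜) :
    Prop where
  contMDiffAt : ContMDiffAt I 𝓘(𝕜, 𝕜) r F (ι σ)
  eventually_eq : ∀ᶠ q in 𝓝 σ, f q = F (ι q)
  eventually_onFun : ∀ᶠ q in 𝓝 σ, Z.onFun F (ι q) = 0
  diff_onFun : diff I (Z.onFun F) (ι σ) = 0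

namespace IsSlice

variable (h : IsSlice r ι τ Z pr) {σ : S}
include h

theorem pr_field (σ : S) : pr σ (Z (ι σ)) = 0 := by
  have h1 : mfderiv J I ι σ (pr σ (Z (ι σ))) = 0 := by
    rw [h.mfderiv_pr]
    have : diff I τ (ι σ) (Z (ι σ)) = 1 := h.onFun_time _
    rw [this, one_smul, sub_self]
  rw [← h.pr_mfderiv σ (pr σ (Z (ι σ))), h1, map_zero]

theorem diff_comp_pr (hr : r ≠ 0) {u : S → 𝕜} {U : N → 𝕜}
    (hU : MDifferentiableAt I 𝓘(𝕜, 𝕜) U (ι σ)) (hu : ∀ᶠ q in 𝓝 σ, u q = U (ι q)) :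
    (diff J u σ).comp (pr σ) = diff I U (ι σ) - Z.onFun U (ι σ) • diff I τ (ι σ) := by
  have h1 : diff J u σ = (diff I U (ι σ)).comp (mfderiv J I ι σ) := by
    rw [diff_congr hu]
    exact (hU.hasMFDerivAt.comp σ ((h.contMDiff σ).mdifferentiableAt hr).hasMFDerivAt).mfderiv
  rw [h1]
  ext v
  change diff I U (ι σ) (mfderiv J I ι σ (pr σ v)) =
    diff I U (ι σ) v - diff I U (ι σ) (Z (ι σ)) * diff I τ (ι σ) v
  rw [h.mfderiv_pr, map_sub, map_smul, smul_eq_mul, mul_comm]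

theorem exists_flatExtension [IsManifold I 1 N] (hr : 1 ≤ r) (hZ : Z.IsSmooth r) {f : S → 𝕜}
    (hf : ContMDiffAt J 𝓘(𝕜, 𝕜) r f σ) : ∃ F, IsFlatExtension I Z r ι σ f F := by
  have hr0 : r ≠ 0 := by rintro rfl; simp at hr
  obtain ⟨ρ, hρ, hρι⟩ := h.exists_retraction σ
  let f₀ : N → 𝕜 := fun z => f (ρ z)
  have hf₀ : ContMDiffAt I 𝓘(𝕜, 𝕜) r f₀ (ι σ) := by
    have h1 := hρι.self_of_nhds
    rw [← h1] at hf
    exact hf.comp (ι σ) hρ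
  have hu := hZ _ _ hf₀
  set u := Z.onFun f₀
  have hw := hZ _ _ hu
  set w := Z.onFun u
  let c : N → 𝕜 := fun z => 2⁻¹ * w z
  have hc : ContMDiffAt I 𝓘(𝕜, 𝕜) r c (ι σ) := contMDiffAt_const.mul hw
  have ha := hZ _ _ hc
  set a := Z.onFun c
  have hτ := h.contMDiff_time
  let F : N → 𝕜 := fun z => (f₀ z - τ z * u z) + (τ z * τ z) * c z
  have hF : ContMDiffAt I 𝓘(𝕜, 𝕜) r F (ι σ) :=
    (hf₀.sub (hτ.contMDiffAt.mul hu)).add ((hτ.contMDiffAt.mul hτ.contMDiffAt).mul hc)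
  have hZF : Z.onFun F =ᶠ[𝓝 (ι σ)] fun z => (τ z * τ z) * a z := by
    filter_upwards [ContMDiffAt.eventually_mdifferentiableAt hr hf₀,
      ContMDiffAt.eventually_mdifferentiableAt hr hu,
      ContMDiffAt.eventually_mdifferentiableAt hr hc] with z h1 h2 h3
    have h4 : MDifferentiableAt I 𝓘(𝕜, 𝕜) τ z := (hτ z).mdifferentiableAt hr0
    have h44 : MDifferentiableAt I 𝓘(𝕜, 𝕜) (fun z => τ z * τ z) z := h4.mul h4
    have h5 : diff I F z = diff I f₀ z - (τ z • diff I u z + u z • diff I τ z) +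
        ((τ z * τ z) • diff I c z + c z • (τ z • diff I τ z + τ z • diff I τ z)) := by
      have h42 : MDifferentiableAt I 𝓘(𝕜, 𝕜) (fun z => τ z * u z) z := h4.mul h2
      rw [← diff_mul h4 h4, ← diff_mul h4 h2, ← diff_mul h44 h3, ← diff_sub h1 h42]
      exact diff_add (h1.sub h42) (h44.mul h3)
    have h6 : Z.onFun τ z = 1 := h.onFun_time z
    have h7 : Z.onFun F z = u z - (τ z * w z + u z * Z.onFun τ z) +
        ((τ z * τ z) * a z + c z * (τ z * Z.onFun τ z + τ z * Z.onFun τ z)) := by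
      rw [VectorField.onFun, h5]
      rfl
    rw [h7, h6]
    simp only [c]
    ring
  refine ⟨F, hF, ?_, ?_, ?_⟩
  · filter_upwards [hρι] with q hq
    simp only [F, h.time_eq, f₀, hq]
    ring
  · filter_upwards [(h.contMDiff σ).continuousAt.eventually hZF] with q hq
    rw [hq, h.time_eq]
    ring
  · have h4 : MDifferentiableAt I 𝓘(𝕜, 𝕜) τ (ι σ) := (hτ _).mdifferentiableAt hr0
    have h44 : MDifferentiableAt I 𝓘(𝕜, 𝕜) (fun z => τ z * τ z) (ι σ) := h4.mul h4
    rw [diff_congr hZF, diff_mul h44 (ha.mdifferentiableAt hr0), diff_mul h4 h4, h.time_eq]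
    ext v
    change 0 * 0 * diff I a (ι σ) v +
      a (ι σ) * (0 * diff I τ (ι σ) v + 0 * diff I τ (ι σ) v) = 0
    ring

theorem diff_onFun_time : diff I (Z.onFun τ) (ι σ) = 0 := by
  have : Z.onFun τ = fun _ => (1 : 𝕜) := funext h.onFun_time
  rw [this, diff_const]

theorem eventually_diff_comp_pr [IsManifold I 1 N] (hr : 1 ≤ r) {f : S → 𝕜} {F : N → 𝕜}
    (hF : IsFlatExtension I Z r ι σ f F) :
    ∀ᶠ q in 𝓝 σ, (diff J f q).comp (pr q) = diff I F (ι q) := by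
  have hr0 : r ≠ 0 := by rintro rfl; simp at hr
  filter_upwards [(h.contMDiff σ).continuousAt.eventually
    (ContMDiffAt.eventually_mdifferentiableAt hr hF.contMDiffAt), hF.eventually_onFun,
    hF.eventually_eq.eventually_nhds] with q h1 h2 h3
  rw [h.diff_comp_pr hr0 h1 h3, h2, sub_zero_smul_covector]

theorem onFun_slice [IsManifold I 1 N] (hr : 1 ≤ r) (π : TwoTensorField I N) {f g : S → 𝕜}
    {F G : N → 𝕜} (hF : IsFlatExtension I Z r ι σ f F) (hG : IsFlatExtension I Z r ι σ g G) :
    ∀ᶠ q in 𝓝 σ, (π.slice pr).onFun f g q = π.onFun F G (ι q) := by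
  filter_upwards [h.eventually_diff_comp_pr hr hF, h.eventually_diff_comp_pr hr hG] with q h1 h2
  rw [TwoTensorField.onFun, TwoTensorField.slice_apply, h1, h2]
  rfl

theorem onFun_sliceField [FiniteDimensional 𝕜 F] [IsManifold I 1 N] (hr : 1 ≤ r)
    (π : TwoTensorField I N) {f : S → 𝕜}
    {F : N → 𝕜} (hF : IsFlatExtension I Z r ι σ f F) :
    ∀ᶠ q in 𝓝 σ, (π.sliceField τ pr).onFun f q = π.onFun τ F (ι q) := by
  filter_upwards [h.eventually_diff_comp_pr hr hF] with q h1
  rw [VectorField.onFun, TwoTensorField.apply_sliceField, h1]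
  rfl

theorem onFun_slice_left [IsManifold I 1 N] (hr : 1 ≤ r) (π : TwoTensorField I N)
    {u g : S → 𝕜} {U G : N → 𝕜} (hU : MDifferentiableAt I 𝓘(𝕜, 𝕜) U (ι σ))
    (hu : ∀ᶠ q in 𝓝 σ, u q = U (ι q)) (hG : IsFlatExtension I Z r ι σ g G) :
    (π.slice pr).onFun u g σ =
      π.onFun U G (ι σ) - Z.onFun U (ι σ) * π.onFun τ G (ι σ) := by
  have hr0 : r ≠ 0 := by rintro rfl; simp at hr
  rw [TwoTensorField.onFun, TwoTensorField.slice_apply, h.diff_comp_pr hr0 hU hu,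
    (h.eventually_diff_comp_pr hr hG).self_of_nhds, map_sub, map_smul]
  rfl

variable [FiniteDimensional 𝕜 F] {π : TwoTensorField I N}

theorem onFun_sliceField_of_eventually (hr : r ≠ 0) (hπ : ∀ p, (π p).IsAlt)
    {u : S → 𝕜} {U : N → 𝕜} (hU : MDifferentiableAt I 𝓘(𝕜, 𝕜) U (ι σ))
    (hu : ∀ᶠ q in 𝓝 σ, u q = U (ι q)) :
    (π.sliceField τ pr).onFun u σ = π.onFun τ U (ι σ) := by
  rw [VectorField.onFun, TwoTensorField.apply_sliceField, h.diff_comp_pr hr hU hu, map_sub,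
    map_smul, (hπ _).self_eq_zero, smul_zero, sub_zero]
  rfl

theorem isJacobi [IsManifold I 1 N] (hr : 1 ≤ r) (hπ : IsHomogeneousPoisson r π Z) :
    IsJacobi r (π.slice pr) (π.sliceField τ pr) := by
  have hr0 : r ≠ 0 := by rintro rfl; simp at hr
  have md : ∀ {σ} {u : N → 𝕜}, ContMDiffAt I 𝓘(𝕜, 𝕜) r u (ι σ) →
    MDifferentiableAt I 𝓘(𝕜, 𝕜) u (ι σ) := fun hu => hu.mdifferentiableAt hr0
  have hτ := h.contMDiff_time
  have halt : ∀ σ, (π.slice pr σ).IsAlt := fun σ α => hπ.alt (ι σ) _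
  have bracket : ∀ {σ} {f g k : S → 𝕜} {F G K : N → 𝕜}, IsFlatExtension I Z r ι σ f F →
      IsFlatExtension I Z r ι σ g G → IsFlatExtension I Z r ι σ k K →
      (π.slice pr).onFun ((π.slice pr).onFun f g) k σ = π.onFun (π.onFun F G) K (ι σ) +
        π.onFun F G (ι σ) * π.onFun τ K (ι σ) := by
    intro σ f g k F G K hF hG hK
    rw [h.onFun_slice_left hr π (md (hπ.smooth _ _ _ hF.contMDiffAt hG.contMDiffAt))
      (h.onFun_slice hr π hF hG) hK, hπ.onFun_onFun_eq_neg hF.contMDiffAt hG.contMDiffAt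
        hF.diff_onFun hG.diff_onFun]
    ring
  have fieldBracket : ∀ {σ} {f g : S → 𝕜} {F G : N → 𝕜}, IsFlatExtension I Z r ι σ f F →
      IsFlatExtension I Z r ι σ g G →
      (π.slice pr).onFun ((π.sliceField τ pr).onFun f) g σ = π.onFun (π.onFun τ F) G (ι σ) +
        π.onFun τ F (ι σ) * π.onFun τ G (ι σ) := by
    intro σ f g F G hF hG
    rw [h.onFun_slice_left hr π (md (hπ.smooth _ _ _ hτ.contMDiffAt hF.contMDiffAt))
      (h.onFun_sliceField hr π hF) hG, hπ.onFun_onFun_eq_neg hτ.contMDiffAt hF.contMDiffAt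
        h.diff_onFun_time hF.diff_onFun]
    ring
  have hZ := hπ.smooth_vectorField
  refine ⟨halt, fun σ f g hf hg => ?_, fun σ f hf => ?_, fun σ f g k hf hg hk => ?_,
    fun σ f g hf hg => ?_⟩
  · obtain ⟨F, hF⟩ := h.exists_flatExtension hr hZ hf
    obtain ⟨G, hG⟩ := h.exists_flatExtension hr hZ hg
    exact ((hπ.smooth _ _ _ hF.contMDiffAt hG.contMDiffAt).comp σ
      (h.contMDiff σ)).congr_of_eventuallyEq (h.onFun_slice hr π hF hG)
  · obtain ⟨F, hF⟩ := h.exists_flatExtension hr hZ hf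
    exact ((hπ.smooth _ _ _ hτ.contMDiffAt hF.contMDiffAt).comp σ
      (h.contMDiff σ)).congr_of_eventuallyEq (h.onFun_sliceField hr π hF)
  · obtain ⟨F, hF⟩ := h.exists_flatExtension hr hZ hf
    obtain ⟨G, hG⟩ := h.exists_flatExtension hr hZ hg
    obtain ⟨K, hK⟩ := h.exists_flatExtension hr hZ hk
    have hS := hπ.schouten _ F G K hF.contMDiffAt hG.contMDiffAt hK.contMDiffAt
    simp only [schoutenSelf, wedge] at hS ⊢
    rw [bracket hF hG hK, bracket hG hK hF, bracket hK hF hG,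
      (h.onFun_sliceField hr π hF).self_of_nhds, (h.onFun_sliceField hr π hG).self_of_nhds,
      (h.onFun_sliceField hr π hK).self_of_nhds, (h.onFun_slice hr π hF hG).self_of_nhds,
      (h.onFun_slice hr π hG hK).self_of_nhds, (h.onFun_slice hr π hK hF).self_of_nhds]
    linear_combination hS
  · obtain ⟨F, hF⟩ := h.exists_flatExtension hr hZ hf
    obtain ⟨G, hG⟩ := h.exists_flatExtension hr hZ hg
    have hS := hπ.schouten _ τ F G hτ.contMDiffAt hF.contMDiffAt hG.contMDiffAt
    have swap : ∀ u v : N → 𝕜, π.onFun u v (ι σ) = - π.onFun v u (ι σ) := fun u v =>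
      congrFun (TwoTensorField.onFun_swap hπ.alt u v) _
    have hGτ : π.onFun (π.onFun G τ) F (ι σ) = - π.onFun (π.onFun τ G) F (ι σ) := by
      rw [TwoTensorField.onFun_swap hπ.alt G τ, TwoTensorField.onFun, diff_neg, map_neg]
      rfl
    have hs : (π.slice pr).onFun f ((π.sliceField τ pr).onFun g) σ =
        - (π.slice pr).onFun ((π.sliceField τ pr).onFun g) f σ :=
      congrFun (TwoTensorField.onFun_swap halt _ _) _
    simp only [schoutenSelf, lieDerivative] at hS ⊢
    rw [h.onFun_sliceField_of_eventually hr0 hπ.alt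
      (md (hπ.smooth _ _ _ hF.contMDiffAt hG.contMDiffAt)) (h.onFun_slice hr π hF hG),
      fieldBracket hF hG, hs, fieldBracket hG hF, swap τ]
    rw [hGτ] at hS
    linear_combination (-2⁻¹ : 𝕜) * hS

theorem isContact [IsManifold I 1 N] (hr : 1 ≤ r) (hπ : IsHomogeneousSymplectic r π Z) {n : ℕ}
    (hF : Module.finrank 𝕜 F = 2 * n + 1) :
    IsContact r n (π.slice pr) (π.sliceField τ pr) := by
  have hJ := h.isJacobi hr hπ.toIsHomogeneousPoisson
  refine ⟨hJ, fun σ => ?_⟩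
  refine (exists_wedgePow_ne_zero_iff hF _ _ σ (hJ.alt σ)).2 fun α c h1 h2 => ?_
  rw [TwoTensorField.apply_sliceField] at h1
  have h1' : π (ι σ) (α.comp (pr σ)) (diff I τ (ι σ)) = 0 := by
    rw [← (hπ.alt _).neg_eq, h1, neg_zero]
  have hτZ : diff I τ (ι σ) (Z (ι σ)) = 1 := h.onFun_time _
  have hγ : α.comp (pr σ) - c • diff I τ (ι σ) = 0 := by
    refine (hπ.nondegenerate (ι σ)).1 _ fun δ => ?_
    have hδ : δ = δ (Z (ι σ)) • diff I τ (ι σ) +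
        (δ.comp (mfderiv J I ι σ)).comp (pr σ) := by
      ext v
      change δ v = δ (Z (ι σ)) * diff I τ (ι σ) v + δ (mfderiv J I ι σ (pr σ v))
      rw [h.mfderiv_pr, map_sub, map_smul, smul_eq_mul]
      ring
    have h3 := h2 (δ.comp (mfderiv J I ι σ))
    rw [TwoTensorField.apply_sliceField, TwoTensorField.slice_apply] at h3
    rw [hδ, map_sub, map_smul, map_add, map_smul, LinearMap.sub_apply, LinearMap.sub_apply,
      LinearMap.smul_apply, LinearMap.smul_apply, h1', h3, (hπ.alt _).self_eq_zero]
    simp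
  have hc : c = 0 := by
    have := congrArg (fun L : Covector I (ι σ) => L (Z (ι σ))) hγ
    change α (pr σ (Z (ι σ))) - c * diff I τ (ι σ) (Z (ι σ)) = 0 at this
    rw [h.pr_field, map_zero, hτZ, zero_sub, mul_one, neg_eq_zero] at this
    exact this
  refine ⟨hc, ?_⟩
  rw [hc, sub_zero_smul_covector] at hγ
  ext v
  have := congrArg (fun L : Covector I (ι σ) => L (mfderiv J I ι σ v)) hγ
  change α (pr σ (mfderiv J I ι σ v)) = 0 at this
  rwa [h.pr_mfderiv] at this

end IsSlice

theorem exists_slice_projection [FiniteDimensional 𝕜 E] [FiniteDimensional 𝕜 F]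
    (hEF : Module.finrank 𝕜 E = Module.finrank 𝕜 F + 1) (A : F →L[𝕜] E) (R : E →L[𝕜] F)
    (hRA : ∀ v, R (A v) = v) (l : E →L[𝕜] 𝕜) (hl : ∀ v, l (A v) = 0) (z : E) (hz : l z = 1) :
    ∃ P : E →L[𝕜] F, (∀ v, P (A v) = v) ∧ ∀ v, A (P v) = v - l v • z := by
  have hrange : LinearMap.range l.toLinearMap = ⊤ :=
    LinearMap.range_eq_top.2 fun c => ⟨c • z, by simp [hz]⟩
  have hker : Module.finrank 𝕜 (LinearMap.ker l.toLinearMap) = Module.finrank 𝕜 F := by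
    have := LinearMap.finrank_range_add_finrank_ker l.toLinearMap
    rw [hrange, finrank_top, Module.finrank_self, hEF] at this
    omega
  have hA : LinearMap.range A.toLinearMap = LinearMap.ker l.toLinearMap := by
    refine Submodule.eq_of_le_of_finrank_eq ?_ ?_
    · rintro _ ⟨v, rfl⟩
      exact hl v
    · rw [hker]
      exact LinearMap.finrank_range_of_inj (Function.LeftInverse.injective hRA)
  refine ⟨R.comp (ContinuousLinearMap.id 𝕜 E - l.smulRight z), fun v => ?_, fun v => ?_⟩
  · simp [hl, hRA]
  · have hv : v - l v • z ∈ LinearMap.range A.toLinearMap := by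
      rw [hA]
      simp [hz]
    obtain ⟨w, hw⟩ := hv
    have hw' : A w = v - l v • z := hw
    change A (R (v - l v • z)) = _
    rw [← hw', hRA]

theorem exists_isSlice [FiniteDimensional 𝕜 E] [FiniteDimensional 𝕜 F]
    (hEF : Module.finrank 𝕜 E = Module.finrank 𝕜 F + 1) (hr : r ≠ 0) (hι : ContMDiff J I r ι)
    (hτ : ContMDiff I 𝓘(𝕜, 𝕜) r τ) (h0 : ∀ σ, τ (ι σ) = 0) (hZ : ∀ p, Z.onFun τ p = 1)
    (hρ : ∀ σ, ∃ ρ : N → S, ContMDiffAt I J r ρ (ι σ) ∧ ∀ᶠ q in 𝓝 σ, ρ (ι q) = q) :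
    ∃ pr, IsSlice (J := J) r ι τ Z pr := by
  have key : ∀ σ, ∃ P : TangentSpace I (ι σ) →L[𝕜] TangentSpace J σ,
      (∀ v, P (mfderiv J I ι σ v) = v) ∧
      ∀ v, mfderiv J I ι σ (P v) = v - diff I τ (ι σ) v • Z (ι σ) := by
    intro σ
    obtain ⟨ρ, hρ1, hρ2⟩ := hρ σ
    have hι' := ((hι σ).mdifferentiableAt hr).hasMFDerivAt
    have h1 : ∀ v : F, (mfderiv I J ρ (ι σ) : E →L[𝕜] F) ((mfderiv J I ι σ : F →L[𝕜] E) v) = v := by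
      intro v
      have h2 := ((hρ1.mdifferentiableAt hr).hasMFDerivAt.comp σ hι').mfderiv
      have h3 : mfderiv J J (ρ ∘ ι) σ = mfderiv J J id σ := EventuallyEq.mfderiv_eq hρ2
      rw [h3, mfderiv_id] at h2
      exact congrArg (fun L : F →L[𝕜] F => L v) h2.symm
    have h4 : ∀ v : F, (diff I τ (ι σ) : E →L[𝕜] 𝕜) ((mfderiv J I ι σ : F →L[𝕜] E) v) = 0 := by
      intro v
      have h5 := (((hτ (ι σ)).mdifferentiableAt hr).hasMFDerivAt.comp σ hι').mfderiv
      have e : τ ∘ ι = fun _ => (0 : 𝕜) := funext h0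
      rw [e, mfderiv_const] at h5
      exact congrArg (fun L : F →L[𝕜] 𝕜 => L v) h5.symm
    exact exists_slice_projection hEF _ _ h1 (diff I τ (ι σ)) h4 (Z (ι σ)) (hZ (ι σ))
  choose pr h1 h2 using key
  exact ⟨pr, hι, hτ, h0, hZ, h1, h2, hρ⟩

end Slice

section SymplecticResolution

universe u

variable {𝕜 : Type} [RCLike 𝕜] {E : Type*} [NormedAddCommGroup E] [NormedSpace 𝕜 E]
  {H : Type*} [TopologicalSpace H] {I : ModelWithCorners 𝕜 E H}
  {M : Type u} [TopologicalSpace M] [ChartedSpace H M]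

/-- If the Poissonification of a Jacobi manifold has a homogeneous symplectic resolution, its slice
`t = 0` is a contact resolution. -/
theorem AdmitsHomogeneousSymplecticResolution.admitsContactResolution {r : WithTop ℕ∞}
    (hr : 1 ≤ r) {n : ℕ} {π : TwoTensorField I M} {X : VectorField I M}
    (h : AdmitsHomogeneousSymplecticResolution r (2 * n + 2) (poissonification π X)
      (poissonificationField I M)) :
    AdmitsContactResolution r n π X := by
  obtain ⟨N, _, _, _, _, πN, Z, φ, hS, hφ, hπ, hZ, hsurj⟩ := h
  have hr0 : r ≠ 0 := by rintro rfl; simp at hr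
  have : IsManifold 𝓘(𝕜, EuclideanSpace 𝕜 (Fin (2 * n + 2))) 1 N := .of_le hr
  let τ : N → 𝕜 := fun p => (φ p).1
  have hτ : ContMDiff 𝓘(𝕜, EuclideanSpace 𝕜 (Fin (2 * n + 2))) 𝓘(𝕜, 𝕜) r τ :=
    contMDiff_fst.comp hφ
  have hφd := fun p => ((hφ p).mdifferentiableAt hr0).hasMFDerivAt
  have hdτ : ∀ p v, diff 𝓘(𝕜, EuclideanSpace 𝕜 (Fin (2 * n + 2))) τ p v =
      (mfderiv 𝓘(𝕜, EuclideanSpace 𝕜 (Fin (2 * n + 2))) (𝓘(𝕜, 𝕜).prod I) φ p v).1 :=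
    fun p v => congrArg (fun L : EuclideanSpace 𝕜 (Fin (2 * n + 2)) →L[𝕜] 𝕜 => L v)
      ((hasMFDerivAt_fst (I := 𝓘(𝕜, 𝕜)) (I' := I) (φ p)).comp p (hφd p)).mfderiv
  have hZτ : ∀ p, Z.onFun τ p = 1 := fun p => by
    rw [VectorField.onFun, hdτ, hZ p]
    rfl
  have hreg : ∀ p, diff 𝓘(𝕜, EuclideanSpace 𝕜 (Fin (2 * n + 2))) τ p ≠ 0 := by
    intro p hp
    have := hZτ p
    rw [VectorField.onFun, hp] at this
    exact zero_ne_one this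
  have hfin : Module.finrank 𝕜 (EuclideanSpace 𝕜 (Fin (2 * n + 2))) =
    Module.finrank 𝕜 (EuclideanSpace 𝕜 (Fin (2 * n + 1))) + 1 := by simp
  obtain ⟨A⟩ := nonempty_embeddedAtlas_levelSet
    (F := EuclideanSpace 𝕜 (Fin (2 * n + 1))) hr hfin hτ hreg
  let S : Type u := {p : N // τ p = 0}
  let ι : S → N := Subtype.val
  let _ : ChartedSpace (EuclideanSpace 𝕜 (Fin (2 * n + 1))) S := A.chartedSpace
  have : IsManifold 𝓘(𝕜, EuclideanSpace 𝕜 (Fin (2 * n + 1))) r S := A.isManifold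
  have hι : ContMDiff 𝓘(𝕜, EuclideanSpace 𝕜 (Fin (2 * n + 1)))
    𝓘(𝕜, EuclideanSpace 𝕜 (Fin (2 * n + 2))) r ι := A.contMDiff
  obtain ⟨pr, hsl⟩ := exists_isSlice (J := 𝓘(𝕜, EuclideanSpace 𝕜 (Fin (2 * n + 1))))
    (Z := Z) hfin hr0 hι hτ (fun σ : S => σ.2) hZτ A.exists_retraction
  have hC : IsContact r n (πN.slice pr) (πN.sliceField τ pr) := hsl.isContact hr hS (by simp)
  have hφS : ContMDiff 𝓘(𝕜, EuclideanSpace 𝕜 (Fin (2 * n + 1))) I r fun σ : S => (φ (ι σ)).2 :=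
    contMDiff_snd.comp (hφ.comp hι)
  have hdφ : ∀ (σ : S) (v : TangentSpace 𝓘(𝕜, EuclideanSpace 𝕜 (Fin (2 * n + 2))) (ι σ)),
      mfderiv 𝓘(𝕜, EuclideanSpace 𝕜 (Fin (2 * n + 1))) I (fun σ : S => (φ (ι σ)).2) σ (pr σ v) =
      (mfderiv 𝓘(𝕜, EuclideanSpace 𝕜 (Fin (2 * n + 2))) (𝓘(𝕜, 𝕜).prod I) φ (ι σ) v).2 := by
    intro σ v
    have h1 := congrArg (fun L : EuclideanSpace 𝕜 (Fin (2 * n + 1)) →L[𝕜] E => L (pr σ v))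
      ((hasMFDerivAt_snd (I := 𝓘(𝕜, 𝕜)) (I' := I) (φ (ι σ))).comp σ
        ((hφd (ι σ)).comp σ ((hι σ).mdifferentiableAt hr0).hasMFDerivAt)).mfderiv
    have h2 := congrArg (mfderiv 𝓘(𝕜, EuclideanSpace 𝕜 (Fin (2 * n + 2))) (𝓘(𝕜, 𝕜).prod I) φ (ι σ))
      (hsl.mfderiv_pr σ v)
    rw [map_sub, map_smul, hZ (ι σ)] at h2
    have h3 := congrArg (fun w : 𝕜 × E => w.2) h2
    refine h1.trans (h3.trans ?_)
    change (mfderiv 𝓘(𝕜, EuclideanSpace 𝕜 (Fin (2 * n + 2))) (𝓘(𝕜, 𝕜).prod I) φ (ι σ) v).2 -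
      diff 𝓘(𝕜, EuclideanSpace 𝕜 (Fin (2 * n + 2))) τ (ι σ) v • (0 : E) = _
    rw [smul_zero, sub_zero]
  have hcov : ∀ (σ : S) (α : Covector I (φ (ι σ)).2),
      (α.comp (mfderiv 𝓘(𝕜, EuclideanSpace 𝕜 (Fin (2 * n + 1))) I
        (fun σ : S => (φ (ι σ)).2) σ)).comp (pr σ) =
      (prodCovector I (φ (ι σ)) 0 α).comp
        (mfderiv 𝓘(𝕜, EuclideanSpace 𝕜 (Fin (2 * n + 2))) (𝓘(𝕜, 𝕜).prod I) φ (ι σ)) := by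
    intro σ α
    ext v
    have := congrArg α (hdφ σ v)
    refine this.trans ?_
    change _ = prodCovector I (φ (ι σ)) 0 α _
    rw [prodCovector_apply, zero_mul, zero_add]
    rfl
  have hcovτ : ∀ σ : S, diff 𝓘(𝕜, EuclideanSpace 𝕜 (Fin (2 * n + 2))) τ (ι σ) =
      (prodCovector I (φ (ι σ)) 1 0).comp
        (mfderiv 𝓘(𝕜, EuclideanSpace 𝕜 (Fin (2 * n + 2))) (𝓘(𝕜, 𝕜).prod I) φ (ι σ)) := by
    intro σ
    ext v
    rw [hdτ]
    change _ = prodCovector I (φ (ι σ)) 1 0 _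
    rw [prodCovector_apply, one_mul]
    exact (add_zero _).symm
  have hexp : ∀ σ : S, (NormedSpace.exp (φ (ι σ)).1)⁻¹ = 1 := fun σ => by
    have : (φ (ι σ)).1 = 0 := σ.2
    rw [this, NormedSpace.exp_zero, inv_one]
  refine ⟨S, inferInstance, inferInstance, A.chartedSpace, A.isManifold, πN.slice pr,
    πN.sliceField τ pr, fun σ => (φ (ι σ)).2, hC, hφS, fun σ α β => ?_, fun σ => ?_, fun y => ?_⟩
  · rw [TwoTensorField.slice_apply, hcov, hcov, hπ (ι σ), poissonification_prodCovector, hexp]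
    ring
  · refine (SeparatingDual.eq_iff_forall_dual_eq (R := 𝕜) (V := E)).2 fun α => ?_
    have h1 := πN.apply_sliceField (τ := τ) (pr := pr) σ
      (ContinuousLinearMap.comp (show Covector I (φ (ι σ)).2 from α)
        (mfderiv 𝓘(𝕜, EuclideanSpace 𝕜 (Fin (2 * n + 1))) I (fun σ : S => (φ (ι σ)).2) σ))
    rw [hcov, hcovτ, hπ (ι σ), poissonification_prodCovector, hexp] at h1
    refine h1.trans ?_
    rw [map_zero, LinearMap.zero_apply, zero_add, one_mul, one_mul, zero_mul, sub_zero]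
    rfl
  · obtain ⟨p, hp⟩ := hsurj (0, y)
    exact ⟨⟨p, congrArg Prod.fst hp⟩, congrArg Prod.snd hp⟩

end SymplecticResolution

end JacobiGeometry

end

open JacobiGeometry

theorem mainTheorem1 {𝕜 : Type} [RCLike 𝕜] (r : WithTop ℕ∞) (hr : r = ∞ ∨ r = ω) (n : ℕ)
    {M : Type*} [TopologicalSpace M] [T2Space M]
    [ChartedSpace (EuclideanSpace 𝕜 (Fin (2 * n + 1))) M]
    [IsManifold 𝓘(𝕜, EuclideanSpace 𝕜 (Fin (2 * n + 1))) r M]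
    (π : TwoTensorField 𝓘(𝕜, EuclideanSpace 𝕜 (Fin (2 * n + 1))) M)
    (X : VectorField 𝓘(𝕜, EuclideanSpace 𝕜 (Fin (2 * n + 1))) M)
    (hJ : IsJacobi r π X) :
    AdmitsContactResolution r n π X ↔
      AdmitsHomogeneousSymplecticResolution r (2 * n + 2) (poissonification π X)
        (poissonificationField 𝓘(𝕜, EuclideanSpace 𝕜 (Fin (2 * n + 1))) M) :=
  ⟨fun h => h.admitsHomogeneousSymplecticResolution hr,
    fun h => h.admitsContactResolution (one_le_of_eq hr)⟩
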